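/- **Theorem 3.18.** A *partial quandle with a binary relation* is a set $X$ with partial operations $*$, $\bar *$ and a relation $\mathcal R\subseteq X\times X$ such that: if $x\mathcal R y$, then $x*y$ and $x\bar * y$ are defined, $x*y\sim x\sim x\bar * y$, and $(x*y)\bar * y=x=(x\bar * y)*y$; if $x\mathcal R x$, then $x*x=x=x\bar * x$; if $x\mathcal R y$, $x\mathcal R z$, $y\mathcal R z$, then $(x*y)*z=(x*z)*(y*z)$. Here $a\sim b$ means that for all $c$: $a\mathcal R c\Leftrightarrow b\mathcal R c$, and $c\mathcal R a\Leftrightarrow c\mathcal R b$. For $n\ge 1$ let $C_n^{PQ}(X)$ be the free abelian group on the $n$-tuples $(x_1,\dots,x_n)$ with $x_i\mathcal R x_j$ for all $i<j$, modulo the subgroup generated by those with $x_i=x_{i+1}$ for some $i$, with $$\partial_n(x_1,\dots,x_n)=\sum_{i=1}^n(-1)^i\big((x_1,\dots,x_{i-1},x_{i+1},\dots,x_n)-(x_1*x_i,\dots,x_{i-1}*x_i,x_{i+1},\dots,x_n)\big)\quad(n\ge 2),$$ and let $H_2^{PQ}(X)=\ker\partial_2/\operatorname{im}\partial_3$. Let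 $D$ be an oriented classical link diagram with components $C_1,\dots,C_s$ and let $R$ be a binary relation on $\{C_1,\dots,C_s\}$. A crossing whose under-arcs lie on $C_i$ and whose over-arc lies on $C_j$ is *good* if $C_iRC_j$, and *bad* otherwise. A *coloring of type II* is a map $f:\mathrm{Arcs}(D)\to X$ such that * if $a$ is an arc of $C_i$, $b$ is an arc of $C_j$ and $C_iRC_j$, then $f(a)\mathcal R f(b)$; * at a good crossing, if the normal of the over-arc $a_2$ (pointing to its left) points from the under-arc $a_1$ to the under-arc $a_3$, then $f(a_3)=f(a_1)*f(a_2)$; * at a bad crossing both under-arcs have the same color. The relation $R$ *permits* a first Reidemeister move on $C_i$ if $C_iRC_i$; a second move in which a strand of $C_j$ lies over a strand of $C_i$ if $C_iRC_j$; and a third move with top, middle and bottom strands on $C_k$, $C_j$, $C_i$ if $C_jRC_k$ and $C_iRC_k$ (the crossing of the middle and the bottom strand may be bad). All orientations are allowed, and all moves are allowed in both directions. Let $f$ be a coloring of type II of $D$. For each component $C_i$ let $z_i(f)\in C_2^{PQ}(X)$ be the sum, over all good crossings whose under-arcs belong to $C_i$, of $(x,y)$ if the crossing is positive and $-(x,y)$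 if it is negative, where $y$ is the color of the over-arc and $x$ is the color of the under-arc away from which the normal of the over-arc points. Then: 1. $\partial_2 z_i(f)=0$ for every $i$. 2. If $D'$ is obtained from $D$ by a Reidemeister move permitted by $R$, then there is exactly one coloring $f'$ of type II of $D'$ that agrees with $f$ outside the disc of the move, and $[z_i(f')]=[z_i(f)]$ in $H_2^{PQ}(X)$ for every $i$. -/

import Mathlib

/-! ### Partial quandles with a binary relation -/

/-- `a` dominates `b` with respect to `r`. -/
def RelDominates {S : Type*} (r : S → S → Prop) (a b : S) : Prop :=
  ∀ c d, (r a c → r b c) ∧ (r d a → r d b)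

/-- `a` and `b` are equivalent with respect to `r`. -/
def RelEquivalent {S : Type*} (r : S → S → Prop) (a b : S) : Prop :=
  RelDominates r a b ∧ RelDominates r b a

/-- A partial quandle with a binary relation `rel`; `star` and `bar` are the two partial binary
operations. -/
structure PartialQuandle (X : Type*) where
  rel : X → X → Prop
  star : X → X → Part X
  bar : X → X → Part X
  defined : ∀ x y, rel x y → (star x y).Dom ∧ (bar x y).Dom
  equivalent : ∀ x y, rel x y →
    (∀ z ∈ star x y, RelEquivalent rel z x) ∧ (∀ z ∈ bar x y, RelEquivalent rel z x)
  idem : ∀ x, rel x x → star x x = Part.some x ∧ bar x x = Part.some x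
  cancel : ∀ x y, rel x y →
    ((star x y).bind fun z => bar z y) = Part.some x ∧
    ((bar x y).bind fun z => star z y) = Part.some x
  distrib : ∀ x y z, rel x y → rel x z → rel y z →
    ((star x y).bind fun u => star u z) =
      (star x z).bind fun u => (star y z).bind fun v => star u v

namespace PartialQuandle

variable {X : Type*} (Q : PartialQuandle X)

/-- The value `x * y` for a related pair `x`, `y`. -/
def mul (x y : X) (h : Q.rel x y) : X := (Q.star x y).get (Q.defined x y h).1

theorem mul_equivalent (x y : X) (h : Q.rel x y) : RelEquivalent Q.rel (Q.mul x y h) x :=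
  (Q.equivalent x y h).1 _ (Part.get_mem _)

theorem rel_mul_left {x y w : X} (h : Q.rel x y) (hw : Q.rel x w) :
    Q.rel (Q.mul x y h) w :=
  ((Q.mul_equivalent x y h).2 w w).1 hw

theorem rel_mul_right {x y w : X} (h : Q.rel x y) (hw : Q.rel w x) :
    Q.rel w (Q.mul x y h) :=
  ((Q.mul_equivalent x y h).2 w w).2 hw

theorem mul_self {x : X} (h : Q.rel x x) : Q.mul x x h = x :=
  Part.get_eq_of_mem (by rw [(Q.idem x h).1]; exact Part.mem_some x) _

/-! ### The chain complex `C^{PQ}` in degrees 1, 2, 3, and its second homology group -/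

/-- Pairs of defect `0`. -/
@[ext] structure Pair where
  fst : X
  snd : X
  rel : Q.rel fst snd

/-- Triples of defect `0`. -/
@[ext] structure Triple where
  fst : X
  snd : X
  trd : X
  rel₁₂ : Q.rel fst snd
  rel₁₃ : Q.rel fst trd
  rel₂₃ : Q.rel snd trd

/-- `C₁^{PR}(X)`, which is also `C₁^{PQ}(X)`, because `C₁^{PD}(X) = 0`. (Every 1-tuple has
defect `0`.) -/
abbrev Chain₁ (_ : PartialQuandle X) := FreeAbelianGroup X

/-- `C₂^{PR}(X)`. -/
abbrev RackChain₂ := FreeAbelianGroup Q.Pair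

/-- `C₃^{PR}(X)`. -/
abbrev RackChain₃ := FreeAbelianGroup Q.Triple

/-- The boundary of a pair,
`-((y) - (y)) + ((x) - (x * y))`. -/
def pairBoundary (p : Q.Pair) : Q.Chain₁ :=
  -(FreeAbelianGroup.of p.snd - FreeAbelianGroup.of p.snd)
    + (FreeAbelianGroup.of p.fst - FreeAbelianGroup.of (Q.mul p.fst p.snd p.rel))

/-- The boundary of a triple,
`-((y, z) - (y, z)) + ((x, z) - (x * y, z)) - ((x, y) - (x * z, y * z))`. -/
def tripleBoundary (t : Q.Triple) : Q.RackChain₂ :=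
  -(FreeAbelianGroup.of ⟨t.snd, t.trd, t.rel₂₃⟩ - FreeAbelianGroup.of ⟨t.snd, t.trd, t.rel₂₃⟩)
    + (FreeAbelianGroup.of ⟨t.fst, t.trd, t.rel₁₃⟩
        - FreeAbelianGroup.of ⟨Q.mul t.fst t.snd t.rel₁₂, t.trd, Q.rel_mul_left _ t.rel₁₃⟩)
    - (FreeAbelianGroup.of ⟨t.fst, t.snd, t.rel₁₂⟩
        - FreeAbelianGroup.of ⟨Q.mul t.fst t.trd t.rel₁₃, Q.mul t.snd t.trd t.rel₂₃,
            Q.rel_mul_left _ (Q.rel_mul_right _ t.rel₁₂)⟩)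

def rackBoundary₂ : Q.RackChain₂ →+ Q.Chain₁ := FreeAbelianGroup.lift Q.pairBoundary

def rackBoundary₃ : Q.RackChain₃ →+ Q.RackChain₂ := FreeAbelianGroup.lift Q.tripleBoundary

/-- `C₂^{PD}(X)`. -/
def Degenerate₂ : AddSubgroup Q.RackChain₂ :=
  AddSubgroup.closure {c | ∃ p : Q.Pair, p.fst = p.snd ∧ c = FreeAbelianGroup.of p}

/-- `C₃^{PD}(X)`. -/
def Degenerate₃ : AddSubgroup Q.RackChain₃ :=
  AddSubgroup.closure
    {c | ∃ t : Q.Triple, (t.fst = t.snd ∨ t.snd = t.trd) ∧ c = FreeAbelianGroup.of t}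

/-- `C₂^{PQ}(X)`. -/
abbrev Chain₂ := Q.RackChain₂ ⧸ Q.Degenerate₂

/-- `C₃^{PQ}(X)`. -/
abbrev Chain₃ := Q.RackChain₃ ⧸ Q.Degenerate₃

theorem degenerate₂_le : Q.Degenerate₂ ≤ Q.rackBoundary₂.ker := by
  refine (AddSubgroup.closure_le _).2 ?_
  rintro c ⟨⟨x, y, h⟩, hxy, rfl⟩
  obtain rfl : x = y := hxy
  simp [rackBoundary₂, pairBoundary, Q.mul_self h]

theorem degenerate₃_le :
    Q.Degenerate₃ ≤ Q.Degenerate₂.comap Q.rackBoundary₃ := by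
  refine (AddSubgroup.closure_le _).2 ?_
  rintro c ⟨⟨x, y, z, hxy, hxz, hyz⟩, h, rfl⟩
  have key : ∀ p : Q.Pair, p.fst = p.snd → FreeAbelianGroup.of p ∈ Q.Degenerate₂ :=
    fun p hp => AddSubgroup.subset_closure ⟨p, hp, rfl⟩
  rcases h with h | h
  · obtain rfl : x = y := h
    simpa [rackBoundary₃, tripleBoundary, Q.mul_self hxy, neg_add_eq_sub] using
      Q.Degenerate₂.add_mem (Q.Degenerate₂.neg_mem (key ⟨x, x, hxy⟩ rfl))
        (key ⟨Q.mul x z hxz, Q.mul x z hxz,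
          Q.rel_mul_left _ (Q.rel_mul_right _ hxy)⟩ rfl)
  · obtain rfl : y = z := h
    simp [rackBoundary₃, tripleBoundary, Q.mul_self hyz]

/-- `∂₂` on `C₂^{PQ}(X)`. -/
def boundary₂ : Q.Chain₂ →+ Q.Chain₁ :=
  QuotientAddGroup.lift Q.Degenerate₂ Q.rackBoundary₂ Q.degenerate₂_le

/-- `∂₃` on `C₃^{PQ}(X)`. -/
def boundary₃ : Q.Chain₃ →+ Q.Chain₂ :=
  QuotientAddGroup.map Q.Degenerate₃ Q.Degenerate₂ Q.rackBoundary₃ Q.degenerate₃_le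

/-- The group of 2-cycles of `C^{PQ}(X)`. -/
def cycles₂ : AddSubgroup Q.Chain₂ := Q.boundary₂.ker

/-- `H₂^{PQ}(X)`, the 2-cycles modulo the image of `∂₃`. -/
abbrev Homology₂ := Q.cycles₂ ⧸ Q.boundary₃.range.addSubgroupOf Q.cycles₂

/-- The homology class of a 2-cycle. -/
def homologyClass (z : Q.Chain₂) (hz : z ∈ Q.cycles₂) : Q.Homology₂ :=
  QuotientAddGroup.mk ⟨z, hz⟩

end PartialQuandle

/-! ### Oriented link diagrams

A diagram is cut into oriented edges by its crossings and by finitely many further marked points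
(at least one on each circle without crossings). The edge that follows the edge `e` along the
orientation is `next e`; the head of `e` is either a passage of a crossing or a marked point. -/

/-- A crossing: `overIn` and `underIn` are its incoming edges on the over-strand and on the
under-strand (the outgoing ones are `next overIn` and `next underIn`), and `positive` is its sign. -/
@[ext] structure Crossing (E : Type*) where
  overIn : E
  underIn : E
  positive : Bool

namespace Crossing

variable {E : Type*}

def map {F : Type*} (g : E → F) (c : Crossing E) : Crossing F :=
  ⟨g c.overIn, g c.underIn, c.positive⟩

/-- An edge has two sides: `(e, true)` is the left side of `e`, walked along `e`, and
`(e, false)` is the right side, walked against the orientation of `e`. So one always walks with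
the adjacent region on the left.

`c.Corner next s s'` says that whoever walks along the side `s` and turns left at the crossing
`c` continues along the side `s'`, that is, `s` and `s'` are consecutive sides of a corner at `c`.

At a positive crossing the four ends are, counterclockwise, over-out, under-out, over-in,
under-in; at a negative crossing they are over-out, under-in, over-in, under-out. -/
def Corner (next : E → E) (c : Crossing E) (s s' : E × Bool) : Prop :=
  match c.positive with
  | true =>
      (s = (c.overIn, true) ∧ s' = (next c.underIn, true)) ∨
      (s = (next c.underIn, false) ∧ s' = (next c.overIn, true)) ∨
      (s = (next c.overIn, false) ∧ s' = (c.underIn, false)) ∨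
      (s = (c.underIn, true) ∧ s' = (c.overIn, false))
  | false =>
      (s = (c.overIn, true) ∧ s' = (c.underIn, false)) ∨
      (s = (c.underIn, true) ∧ s' = (next c.overIn, true)) ∨
      (s = (next c.overIn, false) ∧ s' = (next c.underIn, true)) ∨
      (s = (next c.underIn, false) ∧ s' = (c.overIn, false))

end Crossing

/-- The combinatorial data of an oriented link diagram with set of edges `E` and set of components
`C`, on a closed oriented surface that is not yet required to be a sphere. The components are the
cycles of `next`. -/
structure SurfaceDiagram (C E : Type*) where
  finite_edges : Finite E
  next : Equiv.Perm E
  comp : E → C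
  comp_surjective : Function.Surjective comp
  comp_eq_iff : ∀ e e', comp e = comp e' ↔ next.SameCycle e e'
  crossings : Finset (Crossing E)
  over_injOn : ∀ c ∈ crossings, ∀ d ∈ crossings, c.overIn = d.overIn → c = d
  under_injOn : ∀ c ∈ crossings, ∀ d ∈ crossings, c.underIn = d.underIn → c = d
  over_ne_under : ∀ c ∈ crossings, ∀ d ∈ crossings, c.overIn ≠ d.underIn

namespace SurfaceDiagram

variable {C E : Type*} (D : SurfaceDiagram C E)

/-- The head of the edge `e` is a marked point, not a crossing. -/
def IsMarked (e : E) : Prop := ∀ c ∈ D.crossings, c.overIn ≠ e ∧ c.underIn ≠ e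

/-- Consecutive sides in the boundary of a region. -/
inductive Turn : E × Bool → E × Bool → Prop
  | corner (c : Crossing E) (hc : c ∈ D.crossings) (s s' : E × Bool) :
      c.Corner D.next s s' → Turn s s'
  | forward (e : E) : D.IsMarked e → Turn (e, true) (D.next e, true)
  | backward (e : E) : D.IsMarked e → Turn (D.next e, false) (e, false)

/-- The closed boundary walks of the regions. -/
def Face := Quot D.Turn

/-- The connected pieces of the underlying graph. -/
def Piece := Quot fun e e' : E =>
  e' = D.next e ∨ ∃ c ∈ D.crossings, e = c.overIn ∧ e' = c.underIn

/-- Every connected piece has genus `0`. A diagram with `n` crossings and `m` edges has `m - 2n`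
marked points, so the Euler characteristic of its surface, which is
`(n + (m - 2n)) - m + #Face = #Face - n`, has to be `2` for each piece. -/
def IsPlanar : Prop := Nat.card D.Face = D.crossings.card + 2 * Nat.card D.Piece

end SurfaceDiagram

/-- An oriented (classical) link diagram with set of edges `E` and set of components `C`. -/
structure LinkDiagram (C E : Type*) extends SurfaceDiagram C E where
  planar : toSurfaceDiagram.IsPlanar

namespace LinkDiagram

variable {C E : Type*} (D : LinkDiagram C E)

/-- The arcs of the diagram: an edge and the next one lie on the same arc unless they are
separated by an undercrossing. -/
def Arc := Quot fun e e' : E => e' = D.next e ∧ ∀ c ∈ D.crossings, c.underIn ≠ e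

/-- The arc that contains a given edge. -/
def arc (e : E) : D.Arc := Quot.mk _ e

theorem comp_next (e : E) : D.comp (D.next e) = D.comp e :=
  ((D.comp_eq_iff e (D.next e)).2 (Equiv.Perm.sameCycle_apply_right.2
    (Equiv.Perm.SameCycle.refl _ _))).symm

/-- The component to which an arc belongs. -/
def arcComp : D.Arc → C :=
  Quot.lift D.comp (by rintro e e' ⟨rfl, -⟩; exact (D.comp_next e).symm)

/-- The relation on the arcs that is induced from a relation `R` on the components. -/
def arcRel (R : C → C → Prop) (a b : D.Arc) : Prop := R (D.arcComp a) (D.arcComp b)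

/-- A crossing is good if `Cᵢ R Cⱼ`, where its under-arcs belong to the component `Cᵢ` and its
over-arc to `Cⱼ`. -/
def IsGood (R : C → C → Prop) (c : Crossing E) : Prop := R (D.comp c.underIn) (D.comp c.overIn)

def overArc (c : Crossing E) : D.Arc := D.arc c.overIn

/-- The under-arc away from which the normal of the over-arc points. The normal points to the
left of the over-arc: this is the incoming under-arc if the crossing is positive, and the
outgoing one if it is negative. -/
def source (c : Crossing E) : D.Arc :=
  if c.positive then D.arc c.underIn else D.arc (D.next c.underIn)

/-- The under-arc towards which the normal of the over-arc points. -/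
def target (c : Crossing E) : D.Arc :=
  if c.positive then D.arc (D.next c.underIn) else D.arc c.underIn

theorem arcComp_source (c : Crossing E) : D.arcComp (D.source c) = D.comp c.underIn := by
  unfold source
  split
  · rfl
  · exact D.comp_next c.underIn

end LinkDiagram

/-! ### Colorings of type II and their 2-chains -/

/-- A coloring of type II of a diagram `D` with a relation `R` on its set of components, with
colors in the partial quandle `Q`. -/
@[ext] structure TypeTwoColoring {X C E : Type*} (Q : PartialQuandle X) (R : C → C → Prop)
    (D : LinkDiagram C E) where
  color : D.Arc → X
  monotone : ∀ a b, D.arcRel R a b → Q.rel (color a) (color b)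
  good : ∀ c ∈ D.crossings, D.IsGood R c →
    color (D.target c) ∈ Q.star (color (D.source c)) (color (D.overArc c))
  bad : ∀ c ∈ D.crossings, ¬ D.IsGood R c → color (D.source c) = color (D.target c)

namespace TypeTwoColoring

variable {X C E : Type*} {Q : PartialQuandle X} {R : C → C → Prop} {D : LinkDiagram C E}

/-- The pair `(x, y)` of colors at a good crossing. -/
def pair (f : TypeTwoColoring Q R D) (c : Crossing E) (hc : D.IsGood R c) : Q.Pair :=
  ⟨f.color (D.source c), f.color (D.overArc c), f.monotone _ _ (by
    unfold LinkDiagram.arcRel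
    rw [D.arcComp_source c]
    exact hc)⟩

open Classical in
/-- The chain `zᵢ` in `C₂^{PQ}(X)`: the signed sum of the pairs of colors over all good
crossings whose under-arcs belong to the component `i`. -/
noncomputable def chain (f : TypeTwoColoring Q R D) (i : C) : Q.Chain₂ :=
  ∑ c ∈ D.crossings,
    if h : D.IsGood R c ∧ D.comp c.underIn = i then
      (if c.positive then (1 : ℤ) else -1) •
        (QuotientAddGroup.mk (FreeAbelianGroup.of (f.pair c h.1)) : Q.Chain₂)
    else 0

end TypeTwoColoring

/-! ### Reidemeister moves

In the diagrams before and after a move, mark enough points that the two diagrams have the same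
edges, crossings of one diagram possibly being marked points of the other. -/

/-- `D'` is obtained from `D` by marking further points (and naming the edges anew). The edge `a`
of `D'` is a piece of the edge `piece a` of `D`, and `last e` is the last piece of `e`. -/
structure IsSubdivision {C E F : Type*} (D : LinkDiagram C E) (D' : LinkDiagram C F)
    (piece : F → E) (last : E → F) : Prop where
  piece_last : ∀ e, piece (last e) = e
  comp_eq : ∀ a, D'.comp a = D.comp (piece a)
  next_last : ∀ e, piece (D'.next (last e)) = D.next e
  next_of_ne : ∀ a, a ≠ last (piece a) → piece (D'.next a) = piece a
  mem_crossings : ∀ c, c ∈ D'.crossings ↔ ∃ d ∈ D.crossings, c = d.map last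

section Moves

variable {C F : Type*}

open Classical in
/-- First move, permitted by `R`, on the strand `e`, `next e`, `next (next e)`: `D'` has a kink
with loop `next e`, and `D` does not. The loop begins over or under, with any sign. -/
def AddsKink (R : C → C → Prop) (D D' : LinkDiagram C F) (e : F) : Prop :=
  D'.next = D.next ∧ D'.comp = D.comp ∧
  D.IsMarked e ∧ D.IsMarked (D.next e) ∧
  R (D.comp e) (D.comp e) ∧
  ∃ s : Bool,
    D'.crossings = insert ⟨e, D.next e, s⟩ D.crossings ∨
    D'.crossings = insert ⟨D.next e, e, s⟩ D.crossings

open Classical in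
/-- Second move, permitted by `R`: in `D'`, but not in `D`, the strand `t`, `next t`,
`next (next t)` passes over the strand `b`, `next b`, `next (next b)` at two crossings of opposite
sign. The two strands are parallel or antiparallel. -/
def AddsBigon (R : C → C → Prop) (D D' : LinkDiagram C F) (t b : F) : Prop :=
  D'.next = D.next ∧ D'.comp = D.comp ∧
  [t, D.next t, b, D.next b].Nodup ∧
  (∀ a ∈ [t, D.next t, b, D.next b], D.IsMarked a) ∧
  R (D.comp b) (D.comp t) ∧
  ∃ s : Bool,
    D'.crossings =
      insert ⟨t, b, s⟩ (insert ⟨D.next t, D.next b, !s⟩ D.crossings) ∨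
    D'.crossings =
      insert ⟨t, D.next b, s⟩ (insert ⟨D.next t, b, !s⟩ D.crossings)

open Classical in
/-- Third move, permitted by `R`: the top strand `t`, `next t`, `next (next t)` moves over the
crossing of the middle strand `m`, `next m`, `next (next m)` and the bottom strand `b`, `next b`,
`next (next b)`. The middle edges `next t`, `next m`, `next b` bound a triangular region, and each
strand meets the other two in the opposite order after the move. The crossing of the middle
strand and the bottom strand may be bad.

In `D`, the edge `tm` (`tb`) leads the top strand to its crossing with the middle (bottom) strand,
and so on. -/
def PassesTriangle (R : C → C → Prop) (D D' : LinkDiagram C F) (t m b : F) : Prop :=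
  D'.next = D.next ∧ D'.comp = D.comp ∧
  [t, D.next t, m, D.next m, b, D.next b].Nodup ∧
  R (D.comp m) (D.comp t) ∧ R (D.comp b) (D.comp t) ∧
  ∃ tm tb mt mb bt bm : F,
    ((tm = t ∧ tb = D.next t) ∨ (tb = t ∧ tm = D.next t)) ∧
    ((mt = m ∧ mb = D.next m) ∨ (mb = m ∧ mt = D.next m)) ∧
    ((bt = b ∧ bm = D.next b) ∨ (bm = b ∧ bt = D.next b)) ∧
  ∃ (s₁ s₂ s₃ : Bool) (S : Finset (Crossing F)),
    D.crossings = insert ⟨tm, mt, s₁⟩ (insert ⟨tb, bt, s₂⟩ (insert ⟨mb, bm, s₃⟩ S)) ∧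
    D'.crossings = insert ⟨tb, mb, s₁⟩ (insert ⟨tm, bm, s₂⟩ (insert ⟨mt, bt, s₃⟩ S)) ∧
  ∃ d₁ d₂ d₃ : Bool,
    ((⟨tm, mt, s₁⟩ : Crossing F).Corner D.next (D.next t, d₁) (D.next m, d₂) ∧
      (⟨mb, bm, s₃⟩ : Crossing F).Corner D.next (D.next m, d₂) (D.next b, d₃) ∧
      (⟨tb, bt, s₂⟩ : Crossing F).Corner D.next (D.next b, d₃) (D.next t, d₁)) ∨
    ((⟨tb, bt, s₂⟩ : Crossing F).Corner D.next (D.next t, d₁) (D.next b, d₃) ∧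
      (⟨mb, bm, s₃⟩ : Crossing F).Corner D.next (D.next b, d₃) (D.next m, d₂) ∧
      (⟨tm, mt, s₁⟩ : Crossing F).Corner D.next (D.next m, d₂) (D.next t, d₁))

/-- The moves permitted by `R` between diagrams with the same edges. The last argument is the set
of the edges inside the disc in which the move takes place. The inverse of a third move is again
a third move. -/
inductive MarkedMove (R : C → C → Prop) : LinkDiagram C F → LinkDiagram C F → Set F → Prop
  | isotopy (D) : MarkedMove R D D ∅
  | first (D D' e) : AddsKink R D D' e → MarkedMove R D D' {D.next e}
  | first_inv (D D' e) : AddsKink R D' D e → MarkedMove R D D' {D.next e}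
  | second (D D' t b) : AddsBigon R D D' t b → MarkedMove R D D' {D.next t, D.next b}
  | second_inv (D D' t b) : AddsBigon R D' D t b → MarkedMove R D D' {D.next t, D.next b}
  | third (D D' t m b) : PassesTriangle R D D' t m b →
      MarkedMove R D D' {D.next t, D.next m, D.next b}

end Moves

/-- A Reidemeister move, permitted by `R`, from `D` to `D'` (or a planar isotopy, a change of the
marked points only). The set `F` consists of the edges of common subdivisions of the two diagrams,
those of `inner` are the ones inside the disc of the move. -/
structure ReidemeisterMove {C E E' : Type*} (F : Type*) (R : C → C → Prop)
    (D : LinkDiagram C E) (D' : LinkDiagram C E') where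
  start : LinkDiagram C F
  finish : LinkDiagram C F
  piece : F → E
  last : E → F
  piece' : F → E'
  last' : E' → F
  subdivision : IsSubdivision D start piece last
  subdivision' : IsSubdivision D' finish piece' last'
  inner : Set F
  move : MarkedMove R start finish inner

/-- Colorings before and after a move correspond to each other if they agree outside the disc of
the move. -/
def ReidemeisterMove.Corresponds {X C E E' F : Type*} {Q : PartialQuandle X} {R : C → C → Prop}
    {D : LinkDiagram C E} {D' : LinkDiagram C E'} (μ : ReidemeisterMove F R D D')
    (f : TypeTwoColoring Q R D) (f' : TypeTwoColoring Q R D') : Prop :=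
  ∀ a, a ∉ μ.inner → f'.color (D'.arc (μ.piece' a)) = f.color (D.arc (μ.piece a))

/-!
Colorings of arcs are the same as functions on the edges that are constant along arcs
(`LinkDiagram.IsEdgeColoring`), and these can be compared between diagrams with the same edges.

The chain of a component is a cycle because every crossing, of either sign, contributes to its
boundary the color of the incoming under-edge minus that of the outgoing one, and colors change
nowhere else; summed over a component, everything cancels
(`LinkDiagram.IsEdgeColoring.edgeChain_mem_cycles₂`).

Marking further points changes neither the colorings nor the chains
(`IsSubdivision.color_last_piece`, `IsSubdivision.edgeChain_comp_piece`), so it suffices to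
treat moves between diagrams with the same edges. The passage of a color under a related color,
with either sign, exists and can be undone
(`PartialQuandle.Step`), which gives existence and uniqueness of the new colors inside the disc.
In the first move, idempotency makes the colors at the kink equal, and its contribution is
degenerate. In the second move, the two crossings undo each other and have opposite contributions.

In the third move, the passages of the bottom strand under the other two, before and after the move,
are the four sides of a square, whose existence for all signs follows from self-distributivity and
cancellation, and whose signed sum is the boundary of a triple (`PartialQuandle.Step.square`). The
only geometric input is that the triangle lies on one side of the top strand: the order of the
crossings along the other two strands decides whether the two crossings on the top strand have the
same sign (`Crossing.Corner.first_iff`), which makes the passage of the middle strand under the top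
strand fit into the square. If the crossing of the middle and the bottom strand is bad, the square
collapses and the chains agree (`PartialQuandle.Step.exchange`).
-/

/-! ### Passing under a strand -/

theorem RelEquivalent.refl {S : Type*} (r : S → S → Prop) (a : S) : RelEquivalent r a a :=
  ⟨fun _ _ => ⟨id, id⟩, fun _ _ => ⟨id, id⟩⟩

theorem RelEquivalent.symm {S : Type*} {r : S → S → Prop} {a b : S} (h : RelEquivalent r a b) :
    RelEquivalent r b a :=
  ⟨h.2, h.1⟩

theorem RelEquivalent.trans {S : Type*} {r : S → S → Prop} {a b c : S}
    (h : RelEquivalent r a b) (h' : RelEquivalent r b c) : RelEquivalent r a c :=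
  ⟨fun x y => ⟨fun hx => (h'.1 x y).1 ((h.1 x y).1 hx), fun hy => (h'.1 x y).2 ((h.1 x y).2 hy)⟩,
    fun x y => ⟨fun hx => (h.2 x y).1 ((h'.2 x y).1 hx), fun hy => (h.2 x y).2 ((h'.2 x y).2 hy)⟩⟩

theorem RelEquivalent.rel {S : Type*} {r : S → S → Prop} {a a' b b' : S}
    (ha : RelEquivalent r a a') (hb : RelEquivalent r b b') (h : r a' b') : r a b :=
  (ha.2 b b).1 ((hb.2 a' a').2 h)

namespace PartialQuandle

variable {X : Type*} (Q : PartialQuandle X)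

/-- A strand of color `x` passes under a strand of color `y` at a crossing of sign `s` and leaves
with the color `x'`: `x * y = x'` if the crossing is positive and `x' * y = x` if it is negative.
That the operation is applied to a related pair is part of the notion. -/
def Step (s : Bool) (y x x' : X) : Prop :=
  match s with
  | true => Q.rel x y ∧ x' ∈ Q.star x y
  | false => Q.rel x' y ∧ x ∈ Q.star x' y

/-- A strand passes under another one at a crossing that is good if `p` holds: at a bad crossing
the color does not change. -/
def Passes (p : Prop) (s : Bool) (y x x' : X) : Prop :=
  (p → Q.Step s y x x') ∧ (¬ p → x' = x)

open Classical in
/-- The class of the pair `(x, y)` in `C₂^{PQ}(X)`, and `0` if the pair is not related. -/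
noncomputable def pairClass (x y : X) : Q.Chain₂ :=
  if h : Q.rel x y then QuotientAddGroup.mk (FreeAbelianGroup.of ⟨x, y, h⟩) else 0

/-- The contribution of the crossing in `PartialQuandle.Step` to the 2-chain. -/
noncomputable def stepClass (s : Bool) (y x x' : X) : Q.Chain₂ :=
  match s with
  | true => Q.pairClass x y
  | false => -Q.pairClass x' y

open Classical in
/-- The contribution of the crossing in `PartialQuandle.Passes` to the 2-chain. -/
noncomputable def passesClass (p : Prop) (s : Bool) (y x x' : X) : Q.Chain₂ :=
  if p then Q.stepClass s y x x' else 0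

variable {Q} {s : Bool} {x x' x'' y z : X}

theorem pairClass_of_rel (h : Q.rel x y) :
    Q.pairClass x y = QuotientAddGroup.mk (FreeAbelianGroup.of ⟨x, y, h⟩) :=
  dif_pos h

theorem Step.reverse (h : Q.Step s y x x') : Q.Step (!s) y x' x := by
  cases s <;> exact h

theorem stepClass_reverse : Q.stepClass (!s) y x' x = -Q.stepClass s y x x' := by
  cases s <;> simp [stepClass]

theorem equivalent_of_mem_star (h : Q.rel x y) (hx : x' ∈ Q.star x y) :
    RelEquivalent Q.rel x' x :=
  (Q.equivalent x y h).1 _ hx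

theorem Step.equivalent (h : Q.Step s y x x') : RelEquivalent Q.rel x' x := by
  cases s
  · exact (equivalent_of_mem_star h.1 h.2).symm
  · exact equivalent_of_mem_star h.1 h.2

theorem Step.rel_source (h : Q.Step s y x x') : Q.rel x y := by
  cases s
  · exact (equivalent_of_mem_star h.1 h.2).rel (RelEquivalent.refl _ _) h.1
  · exact h.1

theorem Step.rel_target (h : Q.Step s y x x') : Q.rel x' y :=
  h.reverse.rel_source

theorem mem_bar_of_mem_star (h : Q.rel x y) (hx : x' ∈ Q.star x y) : x ∈ Q.bar x' y := by
  have := (Q.cancel x y h).1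
  rw [Part.eq_some_iff.2 hx, Part.bind_some] at this
  rw [this]
  exact Part.mem_some x

theorem mem_star_of_mem_bar (h : Q.rel x y) (hx : x' ∈ Q.bar x y) : x ∈ Q.star x' y := by
  have := (Q.cancel x y h).2
  rw [Part.eq_some_iff.2 hx, Part.bind_some] at this
  rw [this]
  exact Part.mem_some x

theorem Step.target_unique (h : Q.Step s y x x') (h' : Q.Step s y x x'') : x' = x'' := by
  cases s
  · exact Part.mem_unique (mem_bar_of_mem_star h.1 h.2) (mem_bar_of_mem_star h'.1 h'.2)
  · exact Part.mem_unique h.2 h'.2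

theorem Step.source_unique (h : Q.Step s y x x'') (h' : Q.Step s y x' x'') : x = x' :=
  h.reverse.target_unique h'.reverse

theorem exists_step (s : Bool) (h : Q.rel x y) : ∃ x', Q.Step s y x x' := by
  cases s
  · have hx := Part.get_mem (Q.defined x y h).2
    have heq := (Q.equivalent x y h).2 _ hx
    exact ⟨_, heq.rel (RelEquivalent.refl _ _) h, mem_star_of_mem_bar h hx⟩
  · exact ⟨_, h, Part.get_mem (Q.defined x y h).1⟩

theorem step_self (s : Bool) (h : Q.rel x x) : Q.Step s x x x := by
  have hx : x ∈ Q.star x x := by rw [(Q.idem x h).1]; exact Part.mem_some x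
  cases s <;> exact ⟨h, hx⟩

theorem pairClass_self : Q.pairClass x x = 0 := by
  unfold pairClass
  split_ifs with h
  · rw [QuotientAddGroup.eq_zero_iff]
    exact AddSubgroup.subset_closure ⟨_, rfl, rfl⟩
  · rfl

theorem stepClass_self : Q.stepClass s x x x = 0 := by
  cases s <;> simp [stepClass, pairClass_self]

theorem boundary₂_stepClass (h : Q.Step s y x x') :
    Q.boundary₂ (Q.stepClass s y x x') = FreeAbelianGroup.of x - FreeAbelianGroup.of x' := by
  have key : ∀ {x x' : X}, Q.rel x y → x' ∈ Q.star x y →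
      Q.boundary₂ (Q.pairClass x y) = FreeAbelianGroup.of x - FreeAbelianGroup.of x' := by
    intro x x' hxy hx'
    rw [pairClass_of_rel hxy]
    have : Q.mul x y hxy = x' := Part.get_eq_of_mem hx' _
    change Q.rackBoundary₂ _ = _
    simp [rackBoundary₂, pairBoundary, this]
  cases s
  · simp [stepClass, key h.1 h.2]
  · exact key h.1 h.2

/-! ### The square behind the third move -/

theorem mem_star_of_mem_star {xy xz yz w : X} (hxy : Q.rel x y) (hxz : Q.rel x z)
    (hyz : Q.rel y z) (h₁ : xy ∈ Q.star x y) (h₂ : xz ∈ Q.star x z) (h₃ : yz ∈ Q.star y z)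
    (hw : w ∈ Q.star xy z) : w ∈ Q.star xz yz := by
  have := Q.distrib x y z hxy hxz hyz
  rw [Part.eq_some_iff.2 h₁, Part.eq_some_iff.2 h₂, Part.eq_some_iff.2 h₃] at this
  simp only [Part.bind_some] at this
  rwa [← this]

theorem triple_mem_range {xy xz yz : X} (hxy : Q.rel x y) (hxz : Q.rel x z)
    (hyz : Q.rel y z) (h₁ : xy ∈ Q.star x y) (h₂ : xz ∈ Q.star x z) (h₃ : yz ∈ Q.star y z) :
    Q.pairClass x z - Q.pairClass xy z - (Q.pairClass x y - Q.pairClass xz yz)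
      ∈ Q.boundary₃.range := by
  refine ⟨QuotientAddGroup.mk (FreeAbelianGroup.of ⟨x, y, z, hxy, hxz, hyz⟩), ?_⟩
  obtain rfl : Q.mul x y hxy = xy := Part.get_eq_of_mem h₁ _
  obtain rfl : Q.mul x z hxz = xz := Part.get_eq_of_mem h₂ _
  obtain rfl : Q.mul y z hyz = yz := Part.get_eq_of_mem h₃ _
  rw [pairClass_of_rel hxz, pairClass_of_rel hxy, pairClass_of_rel (Q.rel_mul_left hxy hxz),
    pairClass_of_rel (Q.rel_mul_left hxz (Q.rel_mul_right hyz hxy))]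
  change (QuotientAddGroup.mk (Q.rackBoundary₃ _) : Q.Chain₂) = _
  simp [rackBoundary₃, tripleBoundary]

/-- Self-distributivity in all signs: the passages under `z` of `x₀`, of `x₁` and of the strand
`u` over them carry the passage of `x₀` to `x₁` under `u` to a passage under `u'`. The four
contributions around this square form the boundary of a triple. -/
theorem Step.square {s₂ s₃ : Bool} {x₀ x₁ x₀' x₁' u u' : X} (h : Q.Step s₃ u x₀ x₁)
    (hu : Q.Step s₂ z u u') (h₀ : Q.Step s₂ z x₀ x₀') (h₁ : Q.Step s₂ z x₁ x₁') :
    Q.Step s₃ u' x₀' x₁' ∧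
      Q.stepClass s₃ u x₀ x₁ + Q.stepClass s₂ z x₁ x₁'
        - (Q.stepClass s₂ z x₀ x₀' + Q.stepClass s₃ u' x₀' x₁') ∈ Q.boundary₃.range := by
  -- Exchanging the roles of `x₀` and `x₁` reverses the sign `s₃`.
  wlog hs : s₃ = true generalizing s₃ x₀ x₁ x₀' x₁'
  · obtain rfl : s₃ = false := by simpa using hs
    obtain ⟨h', hmem⟩ := this h.reverse h₁ h₀ rfl
    refine ⟨h'.reverse, ?_⟩
    rw [← AddSubgroup.neg_mem_iff]
    convert hmem using 1
    rw [stepClass_reverse, stepClass_reverse]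
    abel
  subst hs
  have hrel : Q.rel x₀' u' :=
    h₀.equivalent.rel hu.equivalent h.1
  cases s₂
  -- For a negative `s₂`, distributivity applies to `x₀'`, `u'`, `z`, and cancelling `z` identifies
  -- the product `x₀' * u'` with `x₁'`.
  · obtain ⟨w, -, hw⟩ := exists_step true hrel
    have hwx : RelEquivalent Q.rel w x₀' := equivalent_of_mem_star hrel hw
    obtain ⟨v, -, hv⟩ := exists_step true (hwx.rel (RelEquivalent.refl _ _) h₀.1)
    obtain rfl : v = x₁ :=
      Part.mem_unique (mem_star_of_mem_star hrel h₀.1 hu.1 hw h₀.2 hu.2 hv) h.2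
    obtain rfl : w = x₁' := Step.source_unique (s := true)
      ⟨hwx.rel (RelEquivalent.refl _ _) h₀.1, hv⟩ h₁
    refine ⟨⟨hrel, hw⟩, ?_⟩
    convert triple_mem_range hrel h₀.1 hu.1 hw h₀.2 hu.2 using 1
    simp only [stepClass]
    abel
  · refine ⟨⟨hrel, mem_star_of_mem_star h.1 h₀.1 hu.1 h.2 h₀.2 hu.2 h₁.2⟩, ?_⟩
    rw [← AddSubgroup.neg_mem_iff]
    convert triple_mem_range h.1 h₀.1 hu.1 h.2 h₀.2 hu.2 using 1
    simp only [stepClass]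
    abel

/-- A strand that passes first under `z` and then under `u'` may as well pass first under `u` and
then under `z`, where `u` passes to `u'` under `z`. The crossing with `u` may be bad. -/
theorem Step.exchange {p : Prop} {s₂ s₃ : Bool} {x₀ x₁ x₂ u u' : X} (hu : Q.Step s₂ z u u')
    (h₁ : Q.Step s₂ z x₀ x₁) (h₂ : Q.Passes p s₃ u' x₁ x₂) :
    ∃ w, Q.Passes p s₃ u x₀ w ∧ Q.Step s₂ z w x₂ ∧
      Q.passesClass p s₃ u x₀ w + Q.stepClass s₂ z w x₂
        - (Q.stepClass s₂ z x₀ x₁ + Q.passesClass p s₃ u' x₁ x₂) ∈ Q.boundary₃.range := by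
  by_cases hp : p
  · replace h₂ := h₂.1 hp
    obtain ⟨w, hw⟩ := exists_step s₃
      (h₁.equivalent.symm.rel hu.equivalent.symm h₂.rel_source)
    obtain ⟨v, hv⟩ := exists_step s₂
      (hw.equivalent.rel (RelEquivalent.refl _ _) h₁.rel_source)
    obtain ⟨h, hmem⟩ := hw.square hu h₁ hv
    obtain rfl := h.target_unique h₂
    refine ⟨w, ⟨fun _ => hw, fun h => (h hp).elim⟩, hv, ?_⟩
    simpa only [passesClass, if_pos hp] using hmem
  · obtain rfl := h₂.2 hp
    refine ⟨x₀, ⟨fun h => (hp h).elim, fun _ => rfl⟩, h₁, ?_⟩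
    simp [passesClass, hp]

/-- The inverse of the exchange in `PartialQuandle.Step.exchange`. -/
theorem Step.exchange_inv {p : Prop} {s₂ s₃ : Bool} {x₀ x₁ x₂ u u' : X} (hu : Q.Step s₂ z u u')
    (h₁ : Q.Passes p s₃ u x₀ x₁) (h₂ : Q.Step s₂ z x₁ x₂) :
    ∃ w, Q.Step s₂ z x₀ w ∧ Q.Passes p s₃ u' w x₂ ∧
      Q.stepClass s₂ z x₀ w + Q.passesClass p s₃ u' w x₂
        - (Q.passesClass p s₃ u x₀ x₁ + Q.stepClass s₂ z x₁ x₂) ∈ Q.boundary₃.range := by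
  by_cases hp : p
  · replace h₁ := h₁.1 hp
    obtain ⟨w, hw⟩ := exists_step s₂
      (h₁.equivalent.symm.rel (RelEquivalent.refl _ _) h₂.rel_source)
    obtain ⟨h, hmem⟩ := h₁.square hu hw h₂
    refine ⟨w, hw, ⟨fun _ => h, fun h => (h hp).elim⟩, ?_⟩
    rw [← AddSubgroup.neg_mem_iff, neg_sub]
    simpa only [passesClass, if_pos hp] using hmem
  · obtain rfl := h₁.2 hp
    refine ⟨x₂, h₂, ⟨fun h => (hp h).elim, fun _ => rfl⟩, ?_⟩
    simp [passesClass, hp]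

theorem Passes.equivalent {p : Prop} (h : Q.Passes p s y x x') : RelEquivalent Q.rel x' x := by
  by_cases hp : p
  · exact (h.1 hp).equivalent
  · rw [h.2 hp]
    exact RelEquivalent.refl _ _

theorem Passes.target_unique {p : Prop} (h : Q.Passes p s y x x') (h' : Q.Passes p s y x x'') :
    x' = x'' := by
  by_cases hp : p
  · exact (h.1 hp).target_unique (h'.1 hp)
  · rw [h.2 hp, h'.2 hp]

/-! ### Colors around a triangle -/

variable (Q) in
/-- The colors around a triangle: `y` is the color of the top strand, the middle strand has the
colors `m₀`, `m₁`, `m₂`, and the bottom strand `b₀`, `b₁`, `b₂`. The middle strand meets the top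
strand first if `p` is true, and the bottom strand meets the top strand first if `q` is true. The
signs `s₁`, `s₂`, `s₃` belong to the crossings top/middle, top/bottom and middle/bottom, the last
of which is good if `good` holds. In both orders, the bottom strand passes under the color `m₁`. -/
def TriangleColors (good : Prop) (p q s₁ s₂ s₃ : Bool) (y m₀ m₁ m₂ b₀ b₁ b₂ : X) : Prop :=
  (if p then Q.Step s₁ y m₀ m₁ ∧ m₂ = m₁ else m₁ = m₀ ∧ Q.Step s₁ y m₁ m₂) ∧
  (if q then Q.Step s₂ y b₀ b₁ ∧ Q.Passes good s₃ m₁ b₁ b₂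
    else Q.Passes good s₃ m₁ b₀ b₁ ∧ Q.Step s₂ y b₁ b₂)

variable (Q) in
/-- The contribution of the crossings on the bottom strand of a triangle to the 2-chain. -/
noncomputable def bottomClass (good : Prop) (q s₂ s₃ : Bool) (y m₁ b₀ b₁ b₂ : X) : Q.Chain₂ :=
  if q then Q.stepClass s₂ y b₀ b₁ + Q.passesClass good s₃ m₁ b₁ b₂
  else Q.passesClass good s₃ m₁ b₀ b₁ + Q.stepClass s₂ y b₁ b₂

namespace TriangleColors

variable {good : Prop} {p q s₁ s₂ s₃ : Bool} {m₀ m₁ m₁' m₂ b₀ b₁ b₁' b₂ : X}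

theorem equivalent (h : Q.TriangleColors good p q s₁ s₂ s₃ y m₀ m₁ m₂ b₀ b₁ b₂) :
    RelEquivalent Q.rel m₁ m₀ ∧ RelEquivalent Q.rel b₁ b₀ := by
  obtain ⟨hm, hb⟩ := h
  constructor
  · cases p
    · exact hm.1 ▸ RelEquivalent.refl _ _
    · exact hm.1.equivalent
  · cases q <;> exact hb.1.equivalent

theorem unique (h : Q.TriangleColors good p q s₁ s₂ s₃ y m₀ m₁ m₂ b₀ b₁ b₂)
    (h' : Q.TriangleColors good p q s₁ s₂ s₃ y m₀ m₁' m₂ b₀ b₁' b₂) : m₁ = m₁' ∧ b₁ = b₁' := by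
  obtain ⟨hm, hb⟩ := h
  obtain ⟨hm', hb'⟩ := h'
  have : m₁ = m₁' := by
    cases p
    · exact hm.1.trans hm'.1.symm
    · exact hm.2.symm.trans hm'.2
  subst this
  refine ⟨rfl, ?_⟩
  cases q <;> exact hb.1.target_unique hb'.1

/-- The algebra of the third move. The hypothesis on the signs says that the two lower strands
cross the top strand in the same direction if and only if, there, both enter the triangle or both
leave it. -/
theorem exists_opposite (h : Q.TriangleColors good p q s₁ s₂ s₃ y m₀ m₁ m₂ b₀ b₁ b₂)
    (hs : s₁ = s₂ ↔ p = q) :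
    ∃ m₁' b₁', Q.TriangleColors good (!p) (!q) s₁ s₂ s₃ y m₀ m₁' m₂ b₀ b₁' b₂ ∧
      Q.bottomClass good (!q) s₂ s₃ y m₁' b₀ b₁' b₂ - Q.bottomClass good q s₂ s₃ y m₁ b₀ b₁ b₂
        ∈ Q.boundary₃.range := by
  obtain ⟨hm, hb⟩ := h
  obtain ⟨m₁', hm', hu⟩ : ∃ m₁',
      (if !p then Q.Step s₁ y m₀ m₁' ∧ m₂ = m₁' else m₁' = m₀ ∧ Q.Step s₁ y m₁' m₂) ∧
      Q.Step (if p then s₁ else !s₁) y m₁' m₁ := by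
    cases p
    · obtain ⟨rfl, hm⟩ := hm
      exact ⟨m₂, ⟨hm, rfl⟩, hm.reverse⟩
    · obtain ⟨hm, rfl⟩ := hm
      exact ⟨m₀, ⟨rfl, hm⟩, hm⟩
  have hsign : (if p then s₁ else !s₁) = (if q then s₂ else !s₂) := by
    revert hs
    cases p <;> cases q <;> cases s₁ <;> cases s₂ <;> simp
  rw [hsign] at hu
  cases q
  · have hu' := hu.reverse
    simp only [Bool.false_eq_true, if_false, Bool.not_not] at hu'
    obtain ⟨w, h₁, h₂, hmem⟩ := hu'.exchange_inv hb.1 hb.2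
    exact ⟨m₁', w, ⟨hm', h₁, h₂⟩, hmem⟩
  · obtain ⟨w, h₁, h₂, hmem⟩ := Step.exchange hu hb.1 hb.2
    exact ⟨m₁', w, ⟨hm', h₁, h₂⟩, hmem⟩

/-- The middle strand contributes the same class in both orders. -/
theorem stepClass_middle (h : Q.TriangleColors good p q s₁ s₂ s₃ y m₀ m₁ m₂ b₀ b₁ b₂) :
    (if p then Q.stepClass s₁ y m₀ m₁ else Q.stepClass s₁ y m₁ m₂) = Q.stepClass s₁ y m₀ m₂ := by
  obtain ⟨hm, -⟩ := h
  cases p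
  · rw [hm.1]
    rfl
  · rw [hm.2]
    rfl

end TriangleColors

end PartialQuandle

/-! ### Colorings of the edges -/

namespace LinkDiagram

variable {X C E : Type*} (Q : PartialQuandle X) (R : C → C → Prop) (D : LinkDiagram C E)

/-- The condition that a coloring `g` of the edges has to satisfy at a crossing. -/
def CrossingRule (g : E → X) (c : Crossing E) : Prop :=
  Q.Passes (D.IsGood R c) c.positive (g c.overIn) (g c.underIn) (g (D.next c.underIn))

/-- A coloring of type II, written as a function on the edges instead of the arcs. -/
structure IsEdgeColoring (g : E → X) : Prop where
  rel : ∀ a b, R (D.comp a) (D.comp b) → Q.rel (g a) (g b)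
  next_eq : ∀ e, (∀ c ∈ D.crossings, c.underIn ≠ e) → g (D.next e) = g e
  rule : ∀ c ∈ D.crossings, D.CrossingRule Q R g c

open Classical in
/-- The contribution of a crossing to the 2-chain of the component `i`. -/
noncomputable def crossingTerm (g : E → X) (i : C) (c : Crossing E) : Q.Chain₂ :=
  if D.IsGood R c ∧ D.comp c.underIn = i then
    Q.stepClass c.positive (g c.overIn) (g c.underIn) (g (D.next c.underIn))
  else 0

/-- The 2-chain of the component `i`, computed from a coloring of the edges. -/
noncomputable def edgeChain (g : E → X) (i : C) : Q.Chain₂ :=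
  ∑ c ∈ D.crossings, D.crossingTerm Q R g i c

variable {Q R D}

theorem eq_of_underIn_eq {c d : Crossing E} (hc : c ∈ D.crossings) (hd : d ∈ D.crossings)
    (h : c.underIn = d.underIn) : c = d :=
  D.under_injOn c hc d hd h

theorem eq_of_overIn_eq {c d : Crossing E} (hc : c ∈ D.crossings) (hd : d ∈ D.crossings)
    (h : c.overIn = d.overIn) : c = d :=
  D.over_injOn c hc d hd h

/-- An edge that leads over a crossing does not lead under a crossing. -/
theorem underIn_ne_of_overIn {c : Crossing E} (hc : c ∈ D.crossings) :
    ∀ d ∈ D.crossings, d.underIn ≠ c.overIn :=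
  fun d hd h => D.over_ne_under c hc d hd h.symm

open Classical in
/-- The colors of the two ends of all edges cancel: each crossing contributes the difference of
the colors of its two under-edges, and colors change nowhere else. -/
theorem IsEdgeColoring.edgeChain_mem_cycles₂ {g : E → X} (hg : D.IsEdgeColoring Q R g) (i : C) :
    D.edgeChain Q R g i ∈ Q.cycles₂ := by
  have := D.finite_edges
  have := Fintype.ofFinite E
  let φ : E → Q.Chain₁ := fun e =>
    if D.comp e = i then FreeAbelianGroup.of (g e) - FreeAbelianGroup.of (g (D.next e)) else 0
  have hterm : ∀ c ∈ D.crossings, Q.boundary₂ (D.crossingTerm Q R g i c) = φ c.underIn := by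
    intro c hc
    obtain ⟨h₁, h₂⟩ := hg.rule c hc
    unfold crossingTerm
    simp only [φ]
    by_cases hgood : D.IsGood R c
    · by_cases hi : D.comp c.underIn = i
      · rw [if_pos ⟨hgood, hi⟩, if_pos hi, PartialQuandle.boundary₂_stepClass (h₁ hgood)]
      · rw [if_neg fun h => hi h.2, if_neg hi, map_zero]
    · rw [if_neg fun h => hgood h.1, h₂ hgood, sub_self, ite_self, map_zero]
  have hsum : ∑ c ∈ D.crossings, φ c.underIn = ∑ e, φ e := by
    rw [← Finset.sum_image (f := φ) (g := Crossing.underIn)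
      fun c hc d hd h => eq_of_underIn_eq hc hd h]
    refine Finset.sum_subset (Finset.subset_univ _) fun e _ he => ?_
    have : g (D.next e) = g e := hg.next_eq e fun c hc h =>
      he (Finset.mem_image.2 ⟨c, hc, h⟩)
    simp [φ, this]
  change Q.boundary₂ _ = 0
  rw [edgeChain, map_sum, Finset.sum_congr rfl hterm, hsum]
  have hφ : ∀ e, φ e = (if D.comp e = i then FreeAbelianGroup.of (g e) else 0) -
      (if D.comp (D.next e) = i then FreeAbelianGroup.of (g (D.next e)) else 0) := by
    intro e
    simp only [φ, D.comp_next]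
    split_ifs <;> simp
  rw [Finset.sum_congr rfl fun e _ => hφ e, Finset.sum_sub_distrib,
    Equiv.sum_comp D.next fun e => if D.comp e = i then FreeAbelianGroup.of (g e) else 0,
    sub_self]

end LinkDiagram

namespace TypeTwoColoring

variable {X C E : Type*} {Q : PartialQuandle X} {R : C → C → Prop} {D : LinkDiagram C E}

/-- The coloring of the edges that belongs to a coloring of the arcs. -/
def edgeColor (f : TypeTwoColoring Q R D) (e : E) : X := f.color (D.arc e)

theorem isEdgeColoring (f : TypeTwoColoring Q R D) : D.IsEdgeColoring Q R f.edgeColor where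
  rel a b h := f.monotone _ _ h
  next_eq e h := congrArg f.color (Quot.sound ⟨rfl, h⟩).symm
  rule c hc := by
    refine ⟨fun h => ?_, fun h => ?_⟩
    · have h₁ := f.good c hc h
      have h₂ : Q.rel (f.color (D.source c)) (f.color (D.overArc c)) := (f.pair c h).rel
      unfold LinkDiagram.target at h₁
      unfold LinkDiagram.source at h₁ h₂
      unfold PartialQuandle.Step
      cases hs : c.positive <;> rw [hs] at h₁ h₂ <;> exact ⟨h₂, h₁⟩
    · have h₁ := f.bad c hc h
      unfold LinkDiagram.target LinkDiagram.source at h₁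
      cases hs : c.positive <;> rw [hs] at h₁
      · exact h₁
      · exact h₁.symm

theorem chain_eq_edgeChain (f : TypeTwoColoring Q R D) (i : C) :
    f.chain i = D.edgeChain Q R f.edgeColor i := by
  unfold chain LinkDiagram.edgeChain LinkDiagram.crossingTerm
  refine Finset.sum_congr rfl fun c _ => ?_
  split_ifs with h hs
  · have h₂ := (f.pair c h.1).rel
    simp only [hs, PartialQuandle.stepClass, one_smul]
    rw [PartialQuandle.pairClass_of_rel]
    · simp only [pair, LinkDiagram.source, hs, if_true]
      rfl
  · have hs : c.positive = false := by simpa using hs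
    have h₂ := (f.pair c h.1).rel
    simp only [hs, PartialQuandle.stepClass, neg_smul, one_smul]
    rw [PartialQuandle.pairClass_of_rel]
    · simp only [pair, LinkDiagram.source, hs]
      rfl
  · rfl

theorem chain_mem_cycles₂ (f : TypeTwoColoring Q R D) (i : C) : f.chain i ∈ Q.cycles₂ := by
  rw [f.chain_eq_edgeChain]
  exact f.isEdgeColoring.edgeChain_mem_cycles₂ i

/-- The coloring of the arcs that belongs to a coloring of the edges. -/
def ofEdgeColoring {g : E → X} (hg : D.IsEdgeColoring Q R g) : TypeTwoColoring Q R D where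
  color := Quot.lift g (by rintro e e' ⟨rfl, h⟩; exact (hg.next_eq e h).symm)
  monotone := by
    rintro ⟨a⟩ ⟨b⟩ h
    exact hg.rel a b h
  good c hc h := by
    have h₁ := (hg.rule c hc).1 h
    unfold LinkDiagram.target LinkDiagram.source
    unfold PartialQuandle.Step at h₁
    cases hs : c.positive <;> rw [hs] at h₁ <;> exact h₁.2
  bad c hc h := by
    have h₁ := (hg.rule c hc).2 h
    unfold LinkDiagram.target LinkDiagram.source
    cases hs : c.positive
    · exact h₁
    · exact h₁.symm

theorem edgeColor_ofEdgeColoring {g : E → X} (hg : D.IsEdgeColoring Q R g) :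
    (ofEdgeColoring hg).edgeColor = g :=
  rfl

theorem edgeColor_injective :
    Function.Injective (edgeColor : TypeTwoColoring Q R D → E → X) := by
  intro f f' h
  refine TypeTwoColoring.ext (funext ?_)
  rintro ⟨e⟩
  exact congrFun h e

end TypeTwoColoring

/-! ### Subdivisions -/

namespace IsSubdivision

variable {X C E F : Type*} {Q : PartialQuandle X} {R : C → C → Prop} {D : LinkDiagram C E}
  {D' : LinkDiagram C F} {piece : F → E} {last : E → F}

theorem map_mem (h : IsSubdivision D D' piece last) {d : Crossing E} (hd : d ∈ D.crossings) :
    d.map last ∈ D'.crossings :=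
  (h.mem_crossings _).2 ⟨d, hd, rfl⟩

theorem last_injective (h : IsSubdivision D D' piece last) : Function.Injective last :=
  Function.LeftInverse.injective h.piece_last

theorem map_injective (h : IsSubdivision D D' piece last) :
    Function.Injective (Crossing.map last) := by
  intro c d hcd
  have h₁ := congrArg Crossing.overIn hcd
  have h₂ := congrArg Crossing.underIn hcd
  have h₃ := congrArg Crossing.positive hcd
  exact Crossing.ext (h.last_injective h₁) (h.last_injective h₂) h₃

theorem comp_last (h : IsSubdivision D D' piece last) (e : E) :
    D'.comp (last e) = D.comp e := by
  rw [h.comp_eq, h.piece_last]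

theorem isGood_map (h : IsSubdivision D D' piece last) (d : Crossing E) :
    D'.IsGood R (d.map last) ↔ D.IsGood R d := by
  simp only [LinkDiagram.IsGood, Crossing.map, h.comp_last]

theorem crossingRule_map (h : IsSubdivision D D' piece last) (g : E → X) (d : Crossing E) :
    D'.CrossingRule Q R (g ∘ piece) (d.map last) ↔ D.CrossingRule Q R g d := by
  unfold LinkDiagram.CrossingRule
  rw [h.isGood_map]
  simp only [Crossing.map, Function.comp_apply, h.next_last, h.piece_last]

theorem isEdgeColoring (h : IsSubdivision D D' piece last) {g : E → X}
    (hg : D.IsEdgeColoring Q R g) : D'.IsEdgeColoring Q R (g ∘ piece) where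
  rel a b hab := hg.rel _ _ (by rwa [h.comp_eq, h.comp_eq] at hab)
  next_eq a ha := by
    by_cases hl : a = last (piece a)
    · rw [hl]
      simp only [Function.comp_apply, h.next_last, h.piece_last]
      exact hg.next_eq _ fun d hd hda => ha _ (h.map_mem hd) (by rw [hl, ← hda]; rfl)
    · simp only [Function.comp_apply, h.next_of_ne a hl]
  rule c hc := by
    obtain ⟨d, hd, rfl⟩ := (h.mem_crossings c).1 hc
    exact (h.crossingRule_map g d).2 (hg.rule d hd)

theorem edgeChain_comp_piece (h : IsSubdivision D D' piece last) (g : E → X) (i : C) :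
    D'.edgeChain Q R (g ∘ piece) i = D.edgeChain Q R g i := by
  classical
  have hcr : D'.crossings = D.crossings.image (Crossing.map last) := by
    ext c
    rw [h.mem_crossings, Finset.mem_image]
    simp only [eq_comm]
  unfold LinkDiagram.edgeChain
  rw [hcr, Finset.sum_image fun c _ d _ hcd => h.map_injective hcd]
  refine Finset.sum_congr rfl fun d _ => ?_
  unfold LinkDiagram.crossingTerm
  rw [h.isGood_map]
  simp only [Crossing.map, Function.comp_apply, h.next_last, h.piece_last, h.comp_last]

/-- The pieces of an edge have the same color: whoever walks from a piece along the component
arrives at the last piece of the edge, and passes no crossing before. -/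
theorem color_last_piece (h : IsSubdivision D D' piece last) {g : F → X}
    (hg : D'.IsEdgeColoring Q R g) (a : F) : g (last (piece a)) = g a := by
  have := D'.finite_edges
  have hcycle : D'.next.SameCycle a (last (piece a)) := by
    rw [← D'.comp_eq_iff, h.comp_last, h.comp_eq]
  obtain ⟨n, hn⟩ := hcycle.exists_nat_pow_eq
  induction n generalizing a with
  | zero =>
    rw [← hn]
    rfl
  | succ n ih =>
    by_cases hl : a = last (piece a)
    · rw [← hl]
    · have hp := h.next_of_ne a hl
      have hstep := ih (D'.next a) (by
        rw [hp]
        exact Equiv.Perm.sameCycle_apply_left.2 hcycle) (by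
        rw [hp, ← hn, pow_succ, Equiv.Perm.mul_apply])
      rw [hp] at hstep
      rw [hstep]
      refine hg.next_eq a fun c hc hca => hl ?_
      obtain ⟨d, -, rfl⟩ := (h.mem_crossings c).1 hc
      rw [← hca]
      simp only [Crossing.map, h.piece_last]

theorem comp_last_comp_piece (h : IsSubdivision D D' piece last) {g : F → X}
    (hg : D'.IsEdgeColoring Q R g) : (g ∘ last) ∘ piece = g :=
  funext (h.color_last_piece hg)

theorem isEdgeColoring_comp_last (h : IsSubdivision D D' piece last) {g : F → X}
    (hg : D'.IsEdgeColoring Q R g) : D.IsEdgeColoring Q R (g ∘ last) where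
  rel a b hab := hg.rel _ _ (by rwa [h.comp_last, h.comp_last])
  next_eq e he := by
    have h₁ := h.color_last_piece hg (D'.next (last e))
    rw [h.next_last] at h₁
    refine h₁.trans (hg.next_eq _ fun c hc hce => ?_)
    obtain ⟨d, hd, rfl⟩ := (h.mem_crossings c).1 hc
    exact he d hd (h.last_injective hce)
  rule d hd := by
    rw [← h.crossingRule_map, h.comp_last_comp_piece hg]
    exact hg.rule _ (h.map_mem hd)

end IsSubdivision

/-! ### Changes inside a disc -/

namespace LinkDiagram

variable {X C F : Type*} {Q : PartialQuandle X} {R : C → C → Prop} {D D' : LinkDiagram C F}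
  {g g' : F → X}

theorem crossingTerm_congr (hn : D'.next = D.next) (hc : D'.comp = D.comp) {c : Crossing F}
    (ho : g' c.overIn = g c.overIn) (hu : g' c.underIn = g c.underIn)
    (hu' : g' (D.next c.underIn) = g (D.next c.underIn)) (i : C) :
    D'.crossingTerm Q R g' i c = D.crossingTerm Q R g i c := by
  unfold crossingTerm IsGood
  rw [hn, hc, ho, hu, hu']

theorem crossingRule_congr (hn : D'.next = D.next) (hc : D'.comp = D.comp) {c : Crossing F}
    (ho : g' c.overIn = g c.overIn) (hu : g' c.underIn = g c.underIn)
    (hu' : g' (D.next c.underIn) = g (D.next c.underIn)) :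
    D'.CrossingRule Q R g' c ↔ D.CrossingRule Q R g c := by
  unfold CrossingRule IsGood
  rw [hn, hc, ho, hu, hu']

/-- If the diagrams `D` and `D'` have the same crossings apart from those on the edges in `W`, and
`g'` differs from a coloring `g` of `D` only inside the disc, then it suffices to check the
conditions on the coloring `g'` of `D'` on the edges in `W`. -/
theorem IsEdgeColoring.of_local (hg : D.IsEdgeColoring Q R g) (hn : D'.next = D.next)
    (hc : D'.comp = D.comp) (W : Set F)
    (hcr : ∀ c : Crossing F, c.underIn ∉ W → (c ∈ D'.crossings ↔ c ∈ D.crossings))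
    (hW : ∀ e, e ∉ W → g' e = g e ∧ g' (D.next e) = g (D.next e))
    (hover : ∀ c ∈ D'.crossings, c.underIn ∉ W → g' c.overIn = g c.overIn)
    (hrel : ∀ e, RelEquivalent Q.rel (g' e) (g e))
    (hnext : ∀ e ∈ W, (∀ c ∈ D'.crossings, c.underIn ≠ e) → g' (D.next e) = g' e)
    (hrule : ∀ c ∈ D'.crossings, c.underIn ∈ W → D'.CrossingRule Q R g' c) :
    D'.IsEdgeColoring Q R g' where
  rel a b hab := (hrel a).rel (hrel b) (hg.rel a b (by rwa [hc] at hab))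
  next_eq e he := by
    rw [hn]
    by_cases heW : e ∈ W
    · exact hnext e heW he
    · rw [(hW e heW).1, (hW e heW).2]
      refine hg.next_eq e fun c hcD hce => he c ((hcr c (by rwa [hce])).2 hcD) hce
  rule c hcD := by
    by_cases hcW : c.underIn ∈ W
    · exact hrule c hcD hcW
    · exact (crossingRule_congr hn hc (hover c hcD hcW) (hW _ hcW).1 (hW _ hcW).2).2
        (hg.rule c ((hcr c hcW).1 hcD))

/-! ### The first move -/

theorem _root_.SurfaceDiagram.IsMarked.underIn_ne {D : SurfaceDiagram C F} {e : F}
    (h : D.IsMarked e) : ∀ c ∈ D.crossings, c.underIn ≠ e :=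
  fun c hc => (h c hc).2

/-- If `D'` has one crossing `k` more than `D`, a kink, then the two diagrams have the same
colorings, and all edges at the kink have the same color. -/
theorem kink_iff {e : F} {k : Crossing F} (hn : D'.next = D.next) (hc : D'.comp = D.comp)
    (he : D.IsMarked e) (hne : D.IsMarked (D.next e)) (hR : R (D.comp e) (D.comp e))
    (hk : (k.overIn = e ∧ k.underIn = D.next e) ∨ (k.overIn = D.next e ∧ k.underIn = e))
    (hcr : ∀ c, c ∈ D'.crossings ↔ c = k ∨ c ∈ D.crossings) :
    (D'.IsEdgeColoring Q R g ↔ D.IsEdgeColoring Q R g) ∧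
      (D.IsEdgeColoring Q R g → g k.underIn = g k.overIn ∧ g (D.next k.underIn) = g k.overIn) := by
  have hkD' : k ∈ D'.crossings := (hcr k).2 (Or.inl rfl)
  have hcomp := D.comp_next e
  have hgood : D'.IsGood R k := by
    unfold IsGood
    rw [hc]
    rcases hk with ⟨h₁, h₂⟩ | ⟨h₁, h₂⟩ <;> rw [h₁, h₂, hcomp] <;> exact hR
  have hgD : D.IsEdgeColoring Q R g →
      g k.underIn = g k.overIn ∧ g (D.next k.underIn) = g k.overIn := by
    intro hg
    have h₁ := hg.next_eq e he.underIn_ne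
    have h₂ := hg.next_eq _ hne.underIn_ne
    rcases hk with ⟨h₃, h₄⟩ | ⟨h₃, h₄⟩ <;> rw [h₃, h₄] <;> simp only [h₁, h₂, and_self]
  have hout : ∀ c : Crossing F, c.underIn ∉ ({e, D.next e} : Set F) →
      (c ∈ D'.crossings ↔ c ∈ D.crossings) := by
    intro c hcW
    rw [hcr, or_iff_right]
    rintro rfl
    rcases hk with ⟨-, h⟩ | ⟨-, h⟩ <;> simp [h] at hcW
  refine ⟨⟨fun hg => ?_, fun hg => ?_⟩, hgD⟩
  · have hover : g (D.next k.overIn) = g k.overIn := by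
      rw [← hn]
      exact hg.next_eq _ (underIn_ne_of_overIn hkD')
    have hstep := (hg.rule k hkD').1 hgood
    rw [hn] at hstep
    have hconst : g (D.next e) = g e ∧ g (D.next (D.next e)) = g (D.next e) := by
      -- The loop has the color of the over-arc, and so has one of the two under-arcs.
      rcases hk with ⟨h₁, h₂⟩ | ⟨h₁, h₂⟩
      · rw [h₁] at hover
        rw [h₁, h₂, hover] at hstep
        exact ⟨hover, (hover.trans
          ((PartialQuandle.step_self _ hstep.rel_source).target_unique hstep)).symm⟩
      · rw [h₁] at hover
        rw [h₁, h₂] at hstep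
        exact ⟨((PartialQuandle.step_self _ hstep.rel_target).source_unique hstep), hover⟩
    refine IsEdgeColoring.of_local hg hn.symm hc.symm {e, D.next e}
      (fun c h => (hout c h).symm) (fun _ _ => ⟨rfl, rfl⟩) (fun _ _ _ => rfl)
      (fun _ => RelEquivalent.refl _ _) ?_ ?_
    · rintro a (rfl | rfl) -
      · rw [hn]; exact hconst.1
      · rw [hn]; exact hconst.2
    · rintro c hcD (h | h)
      · exact (he.underIn_ne c hcD h).elim
      · exact (hne.underIn_ne c hcD h).elim
  · have h₁ := hg.next_eq e he.underIn_ne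
    have h₂ := hg.next_eq _ hne.underIn_ne
    refine IsEdgeColoring.of_local hg hn hc {e, D.next e} hout (fun _ _ => ⟨rfl, rfl⟩)
      (fun _ _ _ => rfl) (fun _ => RelEquivalent.refl _ _) ?_ ?_
    · rintro a (rfl | rfl) -
      · exact h₁
      · exact h₂
    · intro c hcD' hcW
      rcases (hcr c).1 hcD' with rfl | hcD
      · refine ⟨fun _ => ?_, fun h => (h hgood).elim⟩
        rw [hn, (hgD hg).1, (hgD hg).2]
        refine PartialQuandle.step_self _ (hg.rel _ _ ?_)
        rcases hk with ⟨h, -⟩ | ⟨h, -⟩ <;> rw [h] <;> simpa only [hcomp] using hR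
      · rcases hcW with h | h
        · exact (he.underIn_ne c hcD h).elim
        · exact (hne.underIn_ne c hcD h).elim

open Classical in
theorem _root_.AddsKink.exists_crossing {e : F} (h : AddsKink R D D' e) :
    ∃ k : Crossing F, k ∉ D.crossings ∧ D'.crossings = insert k D.crossings ∧
      ((k.overIn = e ∧ k.underIn = D.next e) ∨ (k.overIn = D.next e ∧ k.underIn = e)) := by
  obtain ⟨-, -, he, hne, -, s, hs | hs⟩ := h
  · exact ⟨_, fun hk => (he _ hk).1 rfl, hs, Or.inl ⟨rfl, rfl⟩⟩
  · exact ⟨_, fun hk => (he _ hk).2 rfl, hs, Or.inr ⟨rfl, rfl⟩⟩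

theorem _root_.AddsKink.isEdgeColoring_iff {e : F} (h : AddsKink R D D' e) :
    D'.IsEdgeColoring Q R g ↔ D.IsEdgeColoring Q R g := by
  classical
  obtain ⟨k, -, hcr, hk⟩ := h.exists_crossing
  obtain ⟨hn, hc, he, hne, hR, -⟩ := h
  exact (kink_iff hn hc he hne hR hk fun c => by rw [hcr, Finset.mem_insert]).1

theorem _root_.AddsKink.edgeChain_eq {e : F} (h : AddsKink R D D' e)
    (hg : D.IsEdgeColoring Q R g) (i : C) :
    D'.edgeChain Q R g i = D.edgeChain Q R g i := by
  classical
  obtain ⟨k, hkD, hcr, hk⟩ := h.exists_crossing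
  obtain ⟨hn, hc, he, hne, hR, -⟩ := h
  obtain ⟨h₁, h₂⟩ :=
    (kink_iff hn hc he hne hR hk fun c => by rw [hcr, Finset.mem_insert]).2 hg
  unfold edgeChain
  rw [hcr, Finset.sum_insert hkD]
  have hzero : D'.crossingTerm Q R g i k = 0 := by
    unfold crossingTerm
    rw [hn, h₁, h₂, PartialQuandle.stepClass_self, ite_self]
  rw [hzero, zero_add]
  exact Finset.sum_congr rfl fun c _ => crossingTerm_congr hn hc rfl rfl rfl i

/-- Without the kink, the edge `next e` lies on the arc of `e`, so a coloring is determined by its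
values on the other edges. -/
theorem _root_.AddsKink.eq_of_agree {e : F} (h : AddsKink R D D' e)
    (hg : D.IsEdgeColoring Q R g) (hg' : D.IsEdgeColoring Q R g')
    (hagree : ∀ a, a ∉ ({D.next e} : Set F) → g' a = g a) : g' = g := by
  classical
  obtain ⟨k, -, hcr, hk⟩ := h.exists_crossing
  obtain ⟨hn, hc, he, hne, hR, -⟩ := h
  have hkD' : k ∈ D'.crossings := by rw [hcr]; simp
  have hne' : e ≠ D.next e := by
    intro heq
    rcases hk with ⟨h₁, h₂⟩ | ⟨h₁, h₂⟩
    · exact D'.over_ne_under k hkD' k hkD' (by rw [h₁, h₂, ← heq])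
    · exact D'.over_ne_under k hkD' k hkD' (by rw [h₁, h₂, ← heq])
  funext a
  by_cases ha : a = D.next e
  · rw [ha, hg.next_eq e he.underIn_ne, hg'.next_eq e he.underIn_ne]
    exact hagree e hne'
  · exact hagree a ha

end LinkDiagram

/-! ### The second move -/

section SecondMove

variable {X C F : Type*} {Q : PartialQuandle X} {R : C → C → Prop} {D D' : LinkDiagram C F}
  {g g' : F → X} {t b : F}

namespace AddsBigon

open Classical in
/-- The two crossings of a bigon, named by the order in which the lower strand meets them. -/
theorem exists_crossings (h : AddsBigon R D D' t b) :
    ∃ (s : Bool) (o₁ o₂ : F),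
      ((o₁ = t ∧ o₂ = D.next t) ∨ (o₁ = D.next t ∧ o₂ = t)) ∧
      D'.crossings = insert ⟨o₁, b, s⟩ (insert ⟨o₂, D.next b, !s⟩ D.crossings) := by
  obtain ⟨-, -, -, -, -, s, hs | hs⟩ := h
  · exact ⟨s, t, D.next t, Or.inl ⟨rfl, rfl⟩, hs⟩
  · refine ⟨!s, D.next t, t, Or.inr ⟨rfl, rfl⟩, ?_⟩
    rw [hs, Bool.not_not, Finset.insert_comm]

/-- The colors at a bigon: the upper strand has one color, and the lower strand recovers its
color after the second crossing. -/
theorem colors (h : AddsBigon R D D' t b) {s : Bool} {o₁ o₂ : F}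
    (ho : (o₁ = t ∧ o₂ = D.next t) ∨ (o₁ = D.next t ∧ o₂ = t))
    (h₁ : (⟨o₁, b, s⟩ : Crossing F) ∈ D'.crossings)
    (h₂ : (⟨o₂, D.next b, !s⟩ : Crossing F) ∈ D'.crossings)
    (hg : D'.IsEdgeColoring Q R g) :
    (g (D.next t) = g t ∧ g (D.next (D.next t)) = g t ∧ g o₁ = g t ∧ g o₂ = g t) ∧
      Q.Step s (g t) (g b) (g (D.next b)) ∧ g (D.next (D.next b)) = g b := by
  obtain ⟨hn, hc, -, -, hR, -⟩ := h
  have hover : ∀ {c : Crossing F}, c ∈ D'.crossings → g (D.next c.overIn) = g c.overIn := by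
    intro c hcD'
    rw [← hn]
    exact hg.next_eq _ (LinkDiagram.underIn_ne_of_overIn hcD')
  have ht : g (D.next t) = g t ∧ g (D.next (D.next t)) = g t ∧ g o₁ = g t ∧ g o₂ = g t := by
    have h₁' := hover h₁
    have h₂' := hover h₂
    rcases ho with ⟨rfl, rfl⟩ | ⟨rfl, rfl⟩
    · exact ⟨h₁', h₂'.trans h₁', rfl, h₁'⟩
    · exact ⟨h₂', h₁'.trans h₂', h₂', rfl⟩
  have hco : D.comp o₁ = D.comp t ∧ D.comp o₂ = D.comp t := by
    rcases ho with ⟨rfl, rfl⟩ | ⟨rfl, rfl⟩ <;> simp only [D.comp_next, and_self]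
  have hs₁ := (hg.rule _ h₁).1 (by
    simpa only [LinkDiagram.IsGood, hc, hco] using hR)
  have hs₂ := (hg.rule _ h₂).1 (by
    simpa only [LinkDiagram.IsGood, hc, hco, D.comp_next] using hR)
  simp only [hn, ht] at hs₁ hs₂
  refine ⟨ht, hs₁, ?_⟩
  have hrev := hs₂.reverse
  rw [Bool.not_not] at hrev
  exact hrev.source_unique hs₁

theorem inner_disjoint (h : AddsBigon R D D' t b) :
    t ∉ ({D.next t, D.next b} : Set F) ∧ b ∉ ({D.next t, D.next b} : Set F) ∧
      D.next (D.next t) ≠ D.next b ∧ D.next (D.next b) ≠ D.next b := by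
  obtain ⟨-, -, hnd, -⟩ := h
  simp only [List.nodup_cons, List.mem_cons, List.not_mem_nil, or_false, not_or] at hnd
  obtain ⟨⟨h₁, h₂, h₃⟩, ⟨h₄, h₅⟩, ⟨h₆, -⟩⟩ := hnd
  refine ⟨?_, ?_, fun h => h₄ (D.next.injective h), fun h => h₆ (D.next.injective h).symm⟩
  · rintro (h | h)
    · exact h₁ h
    · exact h₃ h
  · rintro (h | h)
    · exact h₄ h.symm
    · exact h₆ h

/-- The crossings of `D` are away from the disc of the move. -/
theorem not_mem_inner (h : AddsBigon R D D' t b) {c : Crossing F} (hcD : c ∈ D.crossings) :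
    c.overIn ∉ ({D.next t, D.next b} : Set F) ∧ c.underIn ∉ ({D.next t, D.next b} : Set F) ∧
      D.next c.underIn ∉ ({D.next t, D.next b} : Set F) := by
  obtain ⟨-, -, -, hm, -⟩ := h
  refine ⟨?_, ?_, ?_⟩
  · rintro (h | h)
    · exact (hm (D.next t) (by simp) c hcD).1 h
    · exact (hm (D.next b) (by simp) c hcD).1 h
  · rintro (h | h)
    · exact (hm (D.next t) (by simp) c hcD).2 h
    · exact (hm (D.next b) (by simp) c hcD).2 h
  · rintro (h | h)
    · exact (hm t (by simp) c hcD).2 (D.next.injective h)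
    · exact (hm b (by simp) c hcD).2 (D.next.injective h)

theorem colors_below (h : AddsBigon R D D' t b) (hg : D.IsEdgeColoring Q R g) :
    g (D.next t) = g t ∧ g (D.next (D.next t)) = g t ∧ g (D.next b) = g b ∧
      g (D.next (D.next b)) = g b := by
  obtain ⟨-, -, -, hm, -⟩ := h
  have hnext : ∀ a ∈ [t, D.next t, b, D.next b], g (D.next a) = g a :=
    fun a ha => hg.next_eq a (hm a ha).underIn_ne
  have h₁ := hnext t (by simp)
  have h₂ := hnext (D.next t) (by simp)
  have h₃ := hnext b (by simp)
  have h₄ := hnext (D.next b) (by simp)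
  exact ⟨h₁, h₂.trans h₁, h₃, h₄.trans h₃⟩

theorem edgeChain_eq (h : AddsBigon R D D' t b) (hg : D'.IsEdgeColoring Q R g')
    (hagree : ∀ a, a ∉ ({D.next t, D.next b} : Set F) → g' a = g a) (i : C) :
    D'.edgeChain Q R g' i = D.edgeChain Q R g i := by
  classical
  obtain ⟨s, o₁, o₂, ho, hcr⟩ := h.exists_crossings
  obtain ⟨⟨-, -, ht₁, ht₂⟩, hstep, hb⟩ := h.colors (s := s) ho (by rw [hcr]; simp)
    (by rw [hcr]; simp) hg
  have hin := fun c hc => h.not_mem_inner (c := c) hc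
  obtain ⟨hn, hc, hnd, hm, hR, -⟩ := h
  have hco : D.comp o₁ = D.comp t ∧ D.comp o₂ = D.comp t := by
    rcases ho with ⟨rfl, rfl⟩ | ⟨rfl, rfl⟩ <;> simp only [D.comp_next, and_self]
  have hk₂ : (⟨o₂, D.next b, !s⟩ : Crossing F) ∉ D.crossings :=
    fun hk => (hm (D.next b) (by simp) _ hk).2 rfl
  have hk₁ : (⟨o₁, b, s⟩ : Crossing F) ∉ insert (⟨o₂, D.next b, !s⟩ : Crossing F) D.crossings := by
    rw [Finset.mem_insert, not_or]
    refine ⟨fun hk => ?_, fun hk => (hm b (by simp) _ hk).2 rfl⟩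
    cases s <;> simp at hk
  unfold LinkDiagram.edgeChain
  rw [hcr, Finset.sum_insert hk₁, Finset.sum_insert hk₂, ← add_assoc]
  have hzero : D'.crossingTerm Q R g' i ⟨o₁, b, s⟩ +
      D'.crossingTerm Q R g' i ⟨o₂, D.next b, !s⟩ = 0 := by
    simp only [LinkDiagram.crossingTerm, LinkDiagram.IsGood, hc, hn, hco, D.comp_next, ht₁, ht₂,
      hb, PartialQuandle.stepClass_reverse]
    split_ifs <;> simp
  rw [hzero, zero_add]
  refine Finset.sum_congr rfl fun c hcD => ?_
  exact LinkDiagram.crossingTerm_congr hn hc (hagree _ (hin c hcD).1) (hagree _ (hin c hcD).2.1)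
    (hagree _ (hin c hcD).2.2) i

theorem eq_of_agree (h : AddsBigon R D D' t b) (hg : D.IsEdgeColoring Q R g)
    (hg' : D.IsEdgeColoring Q R g')
    (hagree : ∀ a, a ∉ ({D.next t, D.next b} : Set F) → g' a = g a) : g' = g := by
  obtain ⟨ht, hb, -⟩ := h.inner_disjoint
  obtain ⟨h₁, -, h₂, -⟩ := h.colors_below hg
  obtain ⟨h₁', -, h₂', -⟩ := h.colors_below hg'
  funext a
  by_cases ha : a ∈ ({D.next t, D.next b} : Set F)
  · rcases ha with rfl | rfl
    · rw [h₁, h₁', hagree t ht]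
    · rw [h₂, h₂', hagree b hb]
  · exact hagree a ha

/-- With the bigon, the color of the middle piece of the lower strand is determined by its first
crossing. -/
theorem eq_of_agree' (h : AddsBigon R D D' t b) (hg : D'.IsEdgeColoring Q R g)
    (hg' : D'.IsEdgeColoring Q R g')
    (hagree : ∀ a, a ∉ ({D.next t, D.next b} : Set F) → g' a = g a) : g' = g := by
  classical
  obtain ⟨ht, hb, -⟩ := h.inner_disjoint
  obtain ⟨s, o₁, o₂, ho, hcr⟩ := h.exists_crossings
  obtain ⟨⟨h₁, -⟩, h₂, -⟩ := h.colors (s := s) ho (by rw [hcr]; simp)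
    (by rw [hcr]; simp) hg
  obtain ⟨⟨h₁', -⟩, h₂', -⟩ := h.colors (s := s) ho (by rw [hcr]; simp)
    (by rw [hcr]; simp) hg'
  rw [hagree t ht, hagree b hb] at h₂'
  funext a
  by_cases ha : a ∈ ({D.next t, D.next b} : Set F)
  · rcases ha with rfl | rfl
    · rw [h₁, h₁', hagree t ht]
    · exact h₂'.target_unique h₂
  · exact hagree a ha

theorem mem_crossings_iff (h : AddsBigon R D D' t b) {c : Crossing F}
    (hcW : c.underIn ∉ ({t, D.next t, b, D.next b} : Set F)) :
    c ∈ D'.crossings ↔ c ∈ D.crossings := by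
  classical
  obtain ⟨s, o₁, o₂, -, hcr⟩ := h.exists_crossings
  rw [hcr, Finset.mem_insert, Finset.mem_insert, or_iff_right, or_iff_right]
  · rintro rfl
    simp at hcW
  · rintro rfl
    simp at hcW

theorem update_eq [DecidableEq F] {w : X} {e : F}
    (he : e ∉ ({t, D.next t, b, D.next b} : Set F)) :
    Function.update g (D.next b) w e = g e ∧
      Function.update g (D.next b) w (D.next e) = g (D.next e) := by
  refine ⟨Function.update_of_ne ?_ _ _, Function.update_of_ne ?_ _ _⟩
  · rintro rfl
    simp at he
  · intro heq
    obtain rfl := D.next.injective heq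
    simp at he

/-- A coloring without the bigon extends to the diagram with the bigon. -/
theorem exists_above (h : AddsBigon R D D' t b) (hg : D.IsEdgeColoring Q R g) :
    ∃ g', D'.IsEdgeColoring Q R g' ∧
      ∀ a, a ∉ ({D.next t, D.next b} : Set F) → g' a = g a := by
  classical
  obtain ⟨s, o₁, o₂, ho, hcr⟩ := h.exists_crossings
  obtain ⟨ht₁, ht₂, hb₁, hb₂⟩ := h.colors_below hg
  obtain ⟨-, -, hdt, hdb⟩ := h.inner_disjoint
  obtain ⟨w, hw⟩ := PartialQuandle.exists_step s (hg.rel b t h.2.2.2.2.1)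
  have hmem := fun c => h.mem_crossings_iff (c := c)
  have hin := fun c hc => h.not_mem_inner (c := c) hc
  obtain ⟨hn, hc, hnd, hm, hR, -⟩ := h
  simp only [List.nodup_cons, List.mem_cons, List.not_mem_nil, or_false, not_or] at hnd
  obtain ⟨⟨h₁, h₂, h₃⟩, ⟨h₄, h₅⟩, ⟨h₆, -⟩⟩ := hnd
  have hco : D.comp o₁ = D.comp t ∧ D.comp o₂ = D.comp t := by
    rcases ho with ⟨rfl, rfl⟩ | ⟨rfl, rfl⟩ <;> simp only [D.comp_next, and_self]
  have hupd : ∀ {a}, a ≠ D.next b → Function.update g (D.next b) w a = g a :=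
    fun ha => Function.update_of_ne ha _ _
  refine ⟨Function.update g (D.next b) w, ?_, fun a ha => hupd fun h => ha (Or.inr h)⟩
  have ho' : Function.update g (D.next b) w o₁ = g t ∧
      Function.update g (D.next b) w o₂ = g t := by
    rcases ho with ⟨rfl, rfl⟩ | ⟨rfl, rfl⟩ <;> simp only [hupd h₃, hupd h₅, ht₁, and_self]
  refine hg.of_local hn hc {t, D.next t, b, D.next b} hmem (fun e he => update_eq he) ?_ ?_ ?_ ?_
  · intro c hcD' hcW
    exact hupd fun h => (hin c ((hmem c hcW).1 hcD')).1 (Or.inr h)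
  · intro e
    by_cases he : e = D.next b
    · rw [he, Function.update_self, hb₁]
      exact hw.equivalent
    · rw [hupd he]
      exact RelEquivalent.refl _ _
  · rintro e (rfl | rfl | rfl | rfl) he
    · rw [hupd h₅, hupd h₃, ht₁]
    · rw [hupd h₅, hupd hdt, ht₁, ht₂]
    · exact (he ⟨o₁, e, s⟩ (by rw [hcr]; simp) rfl).elim
    · exact (he ⟨o₂, D.next b, !s⟩ (by rw [hcr]; simp) rfl).elim
  · intro c hcD' hcW
    rw [hcr, Finset.mem_insert, Finset.mem_insert] at hcD'
    have hgood : ∀ {o u : F} {s : Bool}, D.comp o = D.comp t → D.comp u = D.comp b →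
        D'.IsGood R ⟨o, u, s⟩ := by
      intro o u s ho hu
      unfold LinkDiagram.IsGood
      rw [hc, ho, hu]
      exact hR
    rcases hcD' with rfl | rfl | hcD
    · refine ⟨fun _ => ?_, fun h => (h (hgood hco.1 rfl)).elim⟩
      rw [hn]
      simpa only [ho'.1, hupd h₆, Function.update_self] using hw
    · refine ⟨fun _ => ?_, fun h => (h (hgood hco.2 (D.comp_next b))).elim⟩
      rw [hn]
      simpa only [ho'.2, hupd hdb, Function.update_self, hb₂] using hw.reverse
    · refine ((hm c.underIn ?_ c hcD).2 rfl).elim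
      simpa using hcW

/-- A coloring with the bigon yields one without it. -/
theorem exists_below (h : AddsBigon R D D' t b) (hg : D'.IsEdgeColoring Q R g) :
    ∃ g', D.IsEdgeColoring Q R g' ∧
      ∀ a, a ∉ ({D.next t, D.next b} : Set F) → g' a = g a := by
  classical
  obtain ⟨s, o₁, o₂, ho, hcr⟩ := h.exists_crossings
  obtain ⟨⟨ht₁, ht₂, -⟩, hw, hb₂⟩ := h.colors (s := s) ho (by rw [hcr]; simp)
    (by rw [hcr]; simp) hg
  obtain ⟨-, -, hdt, hdb⟩ := h.inner_disjoint
  have hmem := fun c => h.mem_crossings_iff (c := c)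
  have hin := fun c hc => h.not_mem_inner (c := c) hc
  obtain ⟨hn, hc, hnd, hm, hR, -⟩ := h
  simp only [List.nodup_cons, List.mem_cons, List.not_mem_nil, or_false, not_or] at hnd
  obtain ⟨⟨h₁, h₂, h₃⟩, ⟨h₄, h₅⟩, ⟨h₆, -⟩⟩ := hnd
  have hupd : ∀ {a}, a ≠ D.next b → Function.update g (D.next b) (g b) a = g a :=
    fun ha => Function.update_of_ne ha _ _
  refine ⟨Function.update g (D.next b) (g b), ?_, fun a ha => hupd fun h => ha (Or.inr h)⟩
  refine hg.of_local hn.symm hc.symm {t, D.next t, b, D.next b} (fun c hcW => (hmem c hcW).symm)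
    (fun e he => ?_) ?_ ?_ ?_ ?_
  · rw [hn]
    exact update_eq he
  · intro c hcD hcW
    exact hupd fun h => (hin c hcD).1 (Or.inr h)
  · intro e
    by_cases he : e = D.next b
    · rw [he, Function.update_self]
      exact hw.equivalent.symm
    · rw [hupd he]
      exact RelEquivalent.refl _ _
  · rw [hn]
    rintro e (rfl | rfl | rfl | rfl) -
    · rw [hupd h₅, hupd h₃, ht₁]
    · rw [hupd h₅, hupd hdt, ht₁, ht₂]
    · rw [Function.update_self, hupd h₆]
    · rw [Function.update_self, hupd hdb, hb₂]
  · intro c hcD hcW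
    refine ((hm c.underIn ?_ c hcD).2 rfl).elim
    simpa using hcW

end AddsBigon

end SecondMove

/-! ### The third move -/

section ThirdMove

variable {X C F : Type*} {Q : PartialQuandle X} {R : C → C → Prop} {D D' : LinkDiagram C F}
  {g g' : F → X} {t m b : F} {o p q s₁ s₂ s₃ : Bool} {S : Finset (Crossing F)}

/-- On a strand `e`, `next e`, `next (next e)` with two crossings, the edge that leads to the first
crossing (`p = true`) or to the second one (`p = false`). -/
def LinkDiagram.strandEdge (D : LinkDiagram C F) (e : F) (p : Bool) : F :=
  if p then e else D.next e

open Classical in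
/-- Three strands `t`, `m`, `b` of `D` cross each other pairwise, `t` over `m` and `b`, and `m` over
`b`; the other crossings are those in `S`. The top strand meets the middle one first if `o` is
true, the middle strand and the bottom strand meet the top one first if `p` and `q` are true. -/
structure HasTriangle (R : C → C → Prop) (D : LinkDiagram C F) (t m b : F)
    (o p q s₁ s₂ s₃ : Bool) (S : Finset (Crossing F)) : Prop where
  nodup : [t, D.next t, m, D.next m, b, D.next b].Nodup
  rel_middle : R (D.comp m) (D.comp t)
  rel_bottom : R (D.comp b) (D.comp t)
  crossings_eq : D.crossings =
    insert ⟨D.strandEdge t o, D.strandEdge m p, s₁⟩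
      (insert ⟨D.strandEdge t !o, D.strandEdge b q, s₂⟩
        (insert ⟨D.strandEdge m !p, D.strandEdge b !q, s₃⟩ S))

namespace Crossing

/-- If the over-edge and the under-edge of a crossing lie on strands `a` and `e`, and the crossing
is a corner of a region that contains the sides `d` of `next a` and `d'` of `next e`, then the
sign decides whether the crossing is the first one on `e`. -/
theorem Corner.first_iff {next : Equiv.Perm F} {a e u v : F} {s d d' : Bool}
    (hu : u = e ∨ u = next e) (hae : a ≠ e) (hae' : a ≠ next e) (hna : next a ≠ e)
    (he : e ≠ next e)
    (h : (⟨v, u, s⟩ : Crossing F).Corner next (next a, d) (next e, d') ∨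
      (⟨v, u, s⟩ : Crossing F).Corner next (next e, d') (next a, d)) : u = e ↔ d = s := by
  have hna' : next a ≠ next e := fun h => hae (next.injective h)
  unfold Corner at h
  rcases hu with rfl | rfl <;> cases s <;>
    simp [hae', hna, he, he.symm, hna', next.injective.eq_iff] at h ⊢ <;> tauto

end Crossing

/-- A third move reverses the order of the crossings on each of the three strands and keeps the
signs. The region between the strands relates the signs on the top strand to these orders. -/
theorem PassesTriangle.hasTriangle (h : PassesTriangle R D D' t m b) :
    ∃ (o p q s₁ s₂ s₃ : Bool) (S : Finset (Crossing F)),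
      (s₁ = s₂ ↔ p = q) ∧ HasTriangle R D t m b o p q s₁ s₂ s₃ S ∧
      HasTriangle R D' t m b (!o) (!p) (!q) s₁ s₂ s₃ S := by
  obtain ⟨hn, hc, hnd, hm, hb, tm, tb, mt, mb, bt, bm, ht', hm', hb', s₁, s₂, s₃, S, hD, hD', d₁,
    d₂, d₃, hd⟩ := h
  have hnd' := hnd
  simp only [List.nodup_cons, List.mem_cons, List.not_mem_nil, or_false, not_or] at hnd'
  obtain ⟨⟨h₁, h₂, h₃, h₄, h₅⟩, ⟨h₆, h₇, h₈, h₉⟩, ⟨h₁₀, h₁₁, h₁₂⟩, ⟨h₁₃, h₁₄⟩, h₁₅, -⟩ := hnd'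
  have hmid : mt = m ↔ d₁ = s₁ :=
    Crossing.Corner.first_iff (hm'.imp (fun h => h.1) fun h => h.2) h₂ h₃ h₆ h₁₀
      (hd.imp (fun h => h.1) fun h => h.2.2)
  have hbot : bt = b ↔ d₁ = s₂ :=
    Crossing.Corner.first_iff (hb'.imp (fun h => h.1) fun h => h.2) h₄ h₅ h₈ h₁₅
      (hd.symm.imp (fun h => h.1) fun h => h.2.2)
  have hedge : ∀ {x y e : F}, ((x = e ∧ y = D.next e) ∨ (y = e ∧ x = D.next e)) → e ≠ D.next e →
      ∃ p : Bool, x = D.strandEdge e p ∧ y = D.strandEdge e !p ∧ (x = e ↔ p = true) := by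
    rintro x y e (⟨rfl, rfl⟩ | ⟨rfl, rfl⟩) hne
    · exact ⟨true, rfl, rfl, by simp⟩
    · exact ⟨false, rfl, rfl, by simpa using hne.symm⟩
  obtain ⟨o, rfl, rfl, -⟩ := hedge ht' h₁
  obtain ⟨p, rfl, rfl, hp⟩ := hedge hm' h₁₀
  obtain ⟨q, rfl, rfl, hq⟩ := hedge hb' h₁₅
  refine ⟨o, p, q, s₁, s₂, s₃, S, ?_, ⟨hnd, hm, hb, hD⟩, ⟨hn ▸ hnd, hc ▸ hm, hc ▸ hb, ?_⟩⟩
  · rw [hp] at hmid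
    rw [hq] at hbot
    revert hmid hbot
    cases p <;> cases q <;> cases s₁ <;> cases s₂ <;> cases d₁ <;> simp
  · rw [hD']
    simp only [LinkDiagram.strandEdge, hn, Bool.not_not]

namespace HasTriangle

theorem mem (h : HasTriangle R D t m b o p q s₁ s₂ s₃ S) :
    (⟨D.strandEdge t o, D.strandEdge m p, s₁⟩ : Crossing F) ∈ D.crossings ∧
      (⟨D.strandEdge t !o, D.strandEdge b q, s₂⟩ : Crossing F) ∈ D.crossings ∧
      (⟨D.strandEdge m !p, D.strandEdge b !q, s₃⟩ : Crossing F) ∈ D.crossings := by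
  rw [h.crossings_eq]
  refine ⟨by simp, by simp, by simp⟩

theorem strandEdge_ne (h : HasTriangle R D t m b o p q s₁ s₂ s₃ S) :
    (∀ i j, D.strandEdge t i ≠ D.strandEdge m j) ∧ (∀ i j, D.strandEdge t i ≠ D.strandEdge b j) ∧
      (∀ i j, D.strandEdge m i ≠ D.strandEdge b j) := by
  have hnd := h.nodup
  simp only [List.nodup_cons, List.mem_cons, List.not_mem_nil, or_false, not_or] at hnd
  obtain ⟨⟨h₁, h₂, h₃, h₄, h₅⟩, ⟨h₆, h₇, h₈, h₉⟩, ⟨h₁₀, h₁₁, h₁₂⟩, ⟨h₁₃, h₁₄⟩, h₁₅, -⟩ := hnd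
  refine ⟨fun i j => ?_, fun i j => ?_, fun i j => ?_⟩ <;> cases i <;> cases j <;> assumption

theorem strandEdge_bottom_ne (h : HasTriangle R D t m b o p q s₁ s₂ s₃ S) (i : Bool) :
    D.strandEdge b i ≠ D.strandEdge b !i := by
  have hnd := h.nodup
  simp only [List.nodup_cons, List.mem_cons, List.not_mem_nil, or_false, not_or] at hnd
  obtain ⟨-, -, -, -, h₁₅, -⟩ := hnd
  cases i
  · exact Ne.symm h₁₅
  · exact h₁₅

theorem comp_strandEdge (e : F) (i : Bool) : D.comp (D.strandEdge e i) = D.comp e := by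
  cases i
  · exact D.comp_next e
  · rfl

theorem colors (h : HasTriangle R D t m b o p q s₁ s₂ s₃ S) (hg : D.IsEdgeColoring Q R g) :
    g (D.next t) = g t ∧ g (D.next (D.next t)) = g t ∧
      Q.TriangleColors (R (D.comp b) (D.comp m)) p q s₁ s₂ s₃ (g t) (g m) (g (D.next m))
        (g (D.next (D.next m))) (g b) (g (D.next b)) (g (D.next (D.next b))) := by
  obtain ⟨k₁, k₂, k₃⟩ := h.mem
  have hover : ∀ {c : Crossing F}, c ∈ D.crossings → g (D.next c.overIn) = g c.overIn :=
    fun hc => hg.next_eq _ (LinkDiagram.underIn_ne_of_overIn hc)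
  have ht : g (D.next t) = g t ∧ g (D.next (D.next t)) = g t := by
    have h₁ := hover k₁
    have h₂ := hover k₂
    cases o
    · exact ⟨h₂, h₁.trans h₂⟩
    · exact ⟨h₁, h₂.trans h₁⟩
  have ht' : ∀ i, g (D.strandEdge t i) = g t := by
    rintro (_ | _)
    · exact ht.1
    · rfl
  have h₁ := (hg.rule _ k₁).1 (by
    simpa only [LinkDiagram.IsGood, comp_strandEdge] using h.rel_middle)
  have h₂ := (hg.rule _ k₂).1 (by
    simpa only [LinkDiagram.IsGood, comp_strandEdge] using h.rel_bottom)
  have h₃ := hg.rule _ k₃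
  have h₄ := hover k₃
  simp only [LinkDiagram.CrossingRule, LinkDiagram.IsGood, comp_strandEdge] at h₃
  simp only [ht'] at h₁ h₂
  -- The crossing over the bottom strand does not change the color of the middle strand.
  have h₅ : g (D.strandEdge m !p) = g (D.next m) := by
    cases p
    · exact h₄.symm
    · rfl
  rw [h₅] at h₃
  refine ⟨ht.1, ht.2, ?_, ?_⟩
  · cases p
    · exact ⟨h₄, h₁⟩
    · exact ⟨h₁, h₄⟩
  · cases q
    · exact ⟨h₃, h₂⟩
    · exact ⟨h₂, h₃⟩

/-- The edges of the three strands that lead to the crossings of the triangle. -/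
def edges (D : LinkDiagram C F) (t m b : F) : Set F :=
  {e | ∃ i, e = D.strandEdge t i ∨ e = D.strandEdge m i ∨ e = D.strandEdge b i}

theorem strandEdge_eq_or_eq (e : F) (i j : Bool) :
    D.strandEdge e i = D.strandEdge e j ∨ D.strandEdge e i = D.strandEdge e !j := by
  cases i <;> cases j <;> simp

/-- The crossings outside the triangle are away from the disc of the move. -/
theorem not_mem_edges (h : HasTriangle R D t m b o p q s₁ s₂ s₃ S)
    (h' : HasTriangle R D' t m b (!o) (!p) (!q) s₁ s₂ s₃ S) (hn : D'.next = D.next)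
    {c : Crossing F} (hcS : c ∈ S) :
    c.overIn ∉ edges D t m b ∧ c.underIn ∉ edges D t m b := by
  obtain ⟨k₁, k₂, k₃⟩ := h.mem
  obtain ⟨k₁', k₂', k₃'⟩ := h'.mem
  have hE : ∀ e i, D'.strandEdge e i = D.strandEdge e i := by
    intro e i
    simp only [LinkDiagram.strandEdge, hn]
  simp only [hE, Bool.not_not] at k₁' k₂' k₃'
  obtain ⟨htm, htb, hmb⟩ := h.strandEdge_ne
  have hcD : c ∈ D.crossings := by
    rw [h.crossings_eq]
    simp [hcS]
  have hcD' : c ∈ D'.crossings := by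
    rw [h'.crossings_eq]
    simp [hcS]
  constructor
  · rintro ⟨i, hc | hc | hc⟩
    · rcases strandEdge_eq_or_eq (D := D) t i o with hi | hi <;> rw [hi] at hc
      · have e₁ := LinkDiagram.eq_of_overIn_eq hcD k₁ hc
        have e₂ := LinkDiagram.eq_of_overIn_eq hcD' k₂' hc
        exact hmb _ _ (congrArg Crossing.underIn (e₁.symm.trans e₂))
      · have e₁ := LinkDiagram.eq_of_overIn_eq hcD k₂ hc
        have e₂ := LinkDiagram.eq_of_overIn_eq hcD' k₁' hc
        exact hmb _ _ (congrArg Crossing.underIn (e₁.symm.trans e₂)).symm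
    · rcases strandEdge_eq_or_eq (D := D) m i p with hi | hi <;> rw [hi] at hc
      · exact D.over_ne_under _ hcD _ k₁ hc
      · exact D'.over_ne_under _ hcD' _ k₁' hc
    · rcases strandEdge_eq_or_eq (D := D) b i q with hi | hi <;> rw [hi] at hc
      · exact D.over_ne_under _ hcD _ k₂ hc
      · exact D.over_ne_under _ hcD _ k₃ hc
  · rintro ⟨i, hc | hc | hc⟩
    · rcases strandEdge_eq_or_eq (D := D) t i o with hi | hi <;> rw [hi] at hc
      · exact D.over_ne_under _ k₁ _ hcD hc.symm
      · exact D.over_ne_under _ k₂ _ hcD hc.symm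
    · rcases strandEdge_eq_or_eq (D := D) m i p with hi | hi <;> rw [hi] at hc
      · exact D'.over_ne_under _ k₃' _ hcD' hc.symm
      · exact D.over_ne_under _ k₃ _ hcD hc.symm
    · rcases strandEdge_eq_or_eq (D := D) b i q with hi | hi <;> rw [hi] at hc
      · have e₁ := LinkDiagram.eq_of_underIn_eq hcD k₂ hc
        have e₂ := LinkDiagram.eq_of_underIn_eq hcD' k₃' hc
        exact htm _ _ (congrArg Crossing.overIn (e₁.symm.trans e₂))
      · have e₁ := LinkDiagram.eq_of_underIn_eq hcD k₃ hc
        have e₂ := LinkDiagram.eq_of_underIn_eq hcD' k₂' hc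
        exact htm _ _ (congrArg Crossing.overIn (e₁.symm.trans e₂)).symm

open Classical in
theorem edgeChain_eq (h : HasTriangle R D t m b o p q s₁ s₂ s₃ S) (hg : D.IsEdgeColoring Q R g)
    (hS : ∀ c ∈ S, c.underIn ∉ edges D t m b) (i : C) :
    D.edgeChain Q R g i =
      (if D.comp m = i then Q.stepClass s₁ (g t) (g m) (g (D.next (D.next m))) else 0) +
      (if D.comp b = i then Q.bottomClass (R (D.comp b) (D.comp m)) q s₂ s₃ (g t) (g (D.next m))
        (g b) (g (D.next b)) (g (D.next (D.next b))) else 0) +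
      ∑ c ∈ S, D.crossingTerm Q R g i c := by
  obtain ⟨ht, -, hcol⟩ := h.colors hg
  obtain ⟨-, -, k₃⟩ := h.mem
  have hmid := hg.next_eq _ (LinkDiagram.underIn_ne_of_overIn k₃)
  obtain ⟨htm, htb, hmb⟩ := h.strandEdge_ne
  have hbb := h.strandEdge_bottom_ne q
  have n₃ : (⟨D.strandEdge m !p, D.strandEdge b !q, s₃⟩ : Crossing F) ∉ S :=
    fun hk => hS _ hk ⟨!q, Or.inr (Or.inr rfl)⟩
  have n₂ : (⟨D.strandEdge t !o, D.strandEdge b q, s₂⟩ : Crossing F) ∉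
      insert (⟨D.strandEdge m !p, D.strandEdge b !q, s₃⟩ : Crossing F) S := by
    rw [Finset.mem_insert, not_or]
    exact ⟨fun hk => hbb (congrArg Crossing.underIn hk),
      fun hk => hS _ hk ⟨q, Or.inr (Or.inr rfl)⟩⟩
  have n₁ : (⟨D.strandEdge t o, D.strandEdge m p, s₁⟩ : Crossing F) ∉
      insert (⟨D.strandEdge t !o, D.strandEdge b q, s₂⟩ : Crossing F)
        (insert (⟨D.strandEdge m !p, D.strandEdge b !q, s₃⟩ : Crossing F) S) := by
    rw [Finset.mem_insert, Finset.mem_insert, not_or, not_or]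
    exact ⟨fun hk => hmb _ _ (congrArg Crossing.underIn hk),
      fun hk => hmb _ _ (congrArg Crossing.underIn hk),
      fun hk => hS _ hk ⟨p, Or.inr (Or.inl rfl)⟩⟩
  have ht' : ∀ i, g (D.strandEdge t i) = g t := by
    rintro (_ | _)
    · exact ht
    · rfl
  have hm' : g (D.strandEdge m !p) = g (D.next m) := by
    cases p
    · exact hmid.symm
    · rfl
  unfold LinkDiagram.edgeChain
  rw [h.crossings_eq, Finset.sum_insert n₁, Finset.sum_insert n₂, Finset.sum_insert n₃,
    ← add_assoc, ← add_assoc, ← hcol.stepClass_middle, add_assoc (D.crossingTerm Q R g i _)]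
  congr 2
  · simp only [LinkDiagram.crossingTerm, LinkDiagram.IsGood, comp_strandEdge, h.rel_middle,
      true_and, ht']
    cases p <;> rfl
  · simp only [LinkDiagram.crossingTerm, LinkDiagram.IsGood, comp_strandEdge, h.rel_bottom,
      true_and, ht', hm', PartialQuandle.bottomClass, PartialQuandle.passesClass]
    cases q <;> by_cases hi : D.comp b = i <;> simp [hi, LinkDiagram.strandEdge, add_comm]

/-- The edges inside the disc of the move. -/
def inner (D : LinkDiagram C F) (t m b : F) : Set F := {D.next t, D.next m, D.next b}

theorem not_mem_inner (h : HasTriangle R D t m b o p q s₁ s₂ s₃ S) :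
    t ∉ inner D t m b ∧ m ∉ inner D t m b ∧ b ∉ inner D t m b ∧
      D.next (D.next t) ∉ inner D t m b ∧ D.next (D.next m) ∉ inner D t m b ∧
      D.next (D.next b) ∉ inner D t m b := by
  have hnd := h.nodup
  simp only [List.nodup_cons, List.mem_cons, List.not_mem_nil, or_false, not_or] at hnd
  simp only [inner, Set.mem_insert_iff, Set.mem_singleton_iff, D.next.injective.eq_iff]
  grind

theorem mem_edges_of_next_mem_inner {e : F} (he : D.next e ∈ inner D t m b) :
    e ∈ edges D t m b := by
  simp only [inner, Set.mem_insert_iff, Set.mem_singleton_iff, D.next.injective.eq_iff] at he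
  exact ⟨true, he⟩

theorem inner_subset_edges : inner D t m b ⊆ edges D t m b :=
  fun _ he => ⟨false, he⟩

/-- Conversely, a function on the edges is a coloring of `D'` if it agrees with a coloring of `D`
outside the disc and has the right colors around the triangle. -/
theorem isEdgeColoring (h : HasTriangle R D t m b o p q s₁ s₂ s₃ S)
    (h' : HasTriangle R D' t m b (!o) (!p) (!q) s₁ s₂ s₃ S) (hn : D'.next = D.next)
    (hc : D'.comp = D.comp) (hg : D.IsEdgeColoring Q R g)
    (hagree : ∀ a, a ∉ inner D t m b → g' a = g a) (ht : g' (D.next t) = g' t)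
    (hcol : Q.TriangleColors (R (D.comp b) (D.comp m)) (!p) (!q) s₁ s₂ s₃ (g t) (g m)
      (g' (D.next m)) (g (D.next (D.next m))) (g b) (g' (D.next b)) (g (D.next (D.next b)))) :
    D'.IsEdgeColoring Q R g' := by
  obtain ⟨ht₁, ht₂, hcol₀⟩ := h.colors hg
  obtain ⟨i₁, i₂, i₃, i₄, i₅, i₆⟩ := h.not_mem_inner
  have hav := fun c hc => h.not_mem_edges h' hn (c := c) hc
  obtain ⟨k₁, k₂, k₃⟩ := h'.mem
  have hE : ∀ e i, D'.strandEdge e i = D.strandEdge e i := by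
    intro e i
    simp only [LinkDiagram.strandEdge, hn]
  simp only [hE, Bool.not_not] at k₁ k₂ k₃
  have hmem : ∀ c : Crossing F, c.underIn ∉ edges D t m b →
      (c ∈ D'.crossings ↔ c ∈ S) ∧ (c ∈ D.crossings ↔ c ∈ S) := by
    intro c hcW
    rw [h.crossings_eq, h'.crossings_eq]
    simp only [Finset.mem_insert, hE]
    refine ⟨⟨?_, fun hc => Or.inr (Or.inr (Or.inr hc))⟩,
      ⟨?_, fun hc => Or.inr (Or.inr (Or.inr hc))⟩⟩ <;>
    · rintro (rfl | rfl | rfl | hc)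
      · exact (hcW ⟨_, Or.inr (Or.inl rfl)⟩).elim
      · exact (hcW ⟨_, Or.inr (Or.inr rfl)⟩).elim
      · exact (hcW ⟨_, Or.inr (Or.inr rfl)⟩).elim
      · exact hc
  have htE : ∀ i, g' (D.strandEdge t i) = g t := by
    rintro (_ | _)
    · exact ht.trans (hagree t i₁)
    · exact hagree t i₁
  rw [← hagree _ i₂, ← hagree _ i₃, ← hagree _ i₅, ← hagree _ i₆] at hcol
  have hover : g' (D.next (D.strandEdge m p)) = g' (D.strandEdge m p) := by
    cases p
    · exact hcol.1.2
    · exact hcol.1.1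
  have hmE : g' (D.strandEdge m p) = g' (D.next m) := by
    cases p
    · rfl
    · exact hover.symm
  refine hg.of_local hn hc (edges D t m b) (fun c hcW => ((hmem c hcW).1.trans (hmem c hcW).2.symm))
    (fun e he => ⟨hagree _ fun hi => he (inner_subset_edges hi),
      hagree _ fun hi => he (mem_edges_of_next_mem_inner hi)⟩) ?_ ?_ ?_ ?_
  · intro c hcD' hcW
    exact hagree _ fun hi => (hav c ((hmem c hcW).1.1 hcD')).1 (inner_subset_edges hi)
  · intro e
    by_cases he : e ∈ inner D t m b
    · rcases he with rfl | rfl | rfl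
      · rw [ht, ht₁, hagree t i₁]
        exact RelEquivalent.refl _ _
      · have h₁ := hcol.equivalent.1
        rw [hagree _ i₂] at h₁
        exact h₁.trans hcol₀.equivalent.1.symm
      · have h₁ := hcol.equivalent.2
        rw [hagree _ i₃] at h₁
        exact h₁.trans hcol₀.equivalent.2.symm
    · rw [hagree e he]
      exact RelEquivalent.refl _ _
  · rintro e ⟨i, rfl | rfl | rfl⟩ he
    · cases i
      · change g' (D.next (D.next t)) = g' (D.next t)
        rw [hagree _ i₄, ht₂, ht, hagree _ i₁]
      · exact ht
    · rcases strandEdge_eq_or_eq (D := D) m i p with hi | hi <;> rw [hi] at he ⊢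
      · exact hover
      · exact (he _ k₁ rfl).elim
    · rcases strandEdge_eq_or_eq (D := D) b i q with hi | hi <;> rw [hi] at he
      · exact (he _ k₃ rfl).elim
      · exact (he _ k₂ rfl).elim
  · rintro c hcD' ⟨i, hcW | hcW | hcW⟩
    · rcases strandEdge_eq_or_eq (D := D) t i o with hi | hi <;> rw [hi] at hcW
      · exact (D'.over_ne_under _ k₂ _ hcD' hcW.symm).elim
      · exact (D'.over_ne_under _ k₁ _ hcD' hcW.symm).elim
    · rcases strandEdge_eq_or_eq (D := D) m i p with hi | hi <;> rw [hi] at hcW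
      · exact (D'.over_ne_under _ k₃ _ hcD' hcW.symm).elim
      · obtain rfl := LinkDiagram.eq_of_underIn_eq hcD' k₁ hcW
        have hgood : D'.IsGood R ⟨D.strandEdge t !o, D.strandEdge m !p, s₁⟩ := by
          simpa only [LinkDiagram.IsGood, hc, comp_strandEdge] using h.rel_middle
        refine ⟨fun _ => ?_, fun hbad => (hbad hgood).elim⟩
        simp only [hn, htE]
        cases p
        · exact hcol.1.1
        · exact hcol.1.2
    · rcases strandEdge_eq_or_eq (D := D) b i q with hi | hi <;> rw [hi] at hcW
      · obtain rfl := LinkDiagram.eq_of_underIn_eq hcD' k₃ hcW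
        simp only [LinkDiagram.CrossingRule, LinkDiagram.IsGood, hn, hc, comp_strandEdge, hmE]
        cases q
        · exact hcol.2.2
        · exact hcol.2.1
      · obtain rfl := LinkDiagram.eq_of_underIn_eq hcD' k₂ hcW
        have hgood : D'.IsGood R ⟨D.strandEdge t o, D.strandEdge b !q, s₂⟩ := by
          simpa only [LinkDiagram.IsGood, hc, comp_strandEdge] using h.rel_bottom
        refine ⟨fun _ => ?_, fun hbad => (hbad hgood).elim⟩
        simp only [hn, htE]
        cases q
        · exact hcol.2.1
        · exact hcol.2.2

/-- A third move carries each coloring to a coloring with a homologous chain. -/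
theorem exists_coloring (h : HasTriangle R D t m b o p q s₁ s₂ s₃ S)
    (h' : HasTriangle R D' t m b (!o) (!p) (!q) s₁ s₂ s₃ S) (hs : s₁ = s₂ ↔ p = q)
    (hn : D'.next = D.next) (hc : D'.comp = D.comp) (hg : D.IsEdgeColoring Q R g) :
    ∃ g', D'.IsEdgeColoring Q R g' ∧ (∀ a, a ∉ inner D t m b → g' a = g a) ∧
      ∀ i, D'.edgeChain Q R g' i - D.edgeChain Q R g i ∈ Q.boundary₃.range := by
  classical
  obtain ⟨ht, -, hcol⟩ := h.colors hg
  obtain ⟨m', b', hcol', hmem⟩ := hcol.exists_opposite hs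
  have hmb : D.next m ≠ D.next b := h.strandEdge_ne.2.2 false false
  have htm : D.next t ≠ D.next m := h.strandEdge_ne.1 false false
  have htb : D.next t ≠ D.next b := h.strandEdge_ne.2.1 false false
  obtain ⟨i₁, i₂, i₃, i₄, i₅, i₆⟩ := h.not_mem_inner
  set g' : F → X := Function.update (Function.update g (D.next m) m') (D.next b) b' with hg'
  have hm' : g' (D.next m) = m' := by
    rw [hg', Function.update_of_ne hmb, Function.update_self]
  have hb' : g' (D.next b) = b' := Function.update_self _ _ _
  have hupd : ∀ {a}, a ≠ D.next m → a ≠ D.next b → g' a = g a := by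
    intro a ha ha'
    rw [hg', Function.update_of_ne ha', Function.update_of_ne ha]
  have hagree : ∀ a, a ∉ inner D t m b → g' a = g a := fun a ha =>
    hupd (fun h => ha (Or.inr (Or.inl h))) fun h => ha (Or.inr (Or.inr h))
  have hcolor : D'.IsEdgeColoring Q R g' := by
    refine h.isEdgeColoring h' hn hc hg hagree ?_ ?_
    · rw [hupd htm htb, hagree t i₁, ht]
    · rwa [hm', hb']
  refine ⟨g', hcolor, hagree, fun i => ?_⟩
  have hav := fun c hc => (h.not_mem_edges h' hn (c := c) hc).2
  have hav' : ∀ c ∈ S, c.underIn ∉ edges D' t m b := by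
    simpa only [edges, LinkDiagram.strandEdge, hn] using hav
  have hsum : ∑ c ∈ S, D'.crossingTerm Q R g' i c = ∑ c ∈ S, D.crossingTerm Q R g i c := by
    refine Finset.sum_congr rfl fun c hcS => ?_
    obtain ⟨ho, hu⟩ := h.not_mem_edges h' hn hcS
    exact LinkDiagram.crossingTerm_congr hn hc (hagree _ fun hi => ho (inner_subset_edges hi))
      (hagree _ fun hi => hu (inner_subset_edges hi))
      (hagree _ fun hi => hu (mem_edges_of_next_mem_inner hi)) i
  rw [h.edgeChain_eq hg hav, h'.edgeChain_eq hcolor hav', hsum]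
  simp only [hn, hc, hm', hb', hagree _ i₁, hagree _ i₂, hagree _ i₃, hagree _ i₅, hagree _ i₆]
  rw [add_sub_add_right_eq_sub, add_sub_add_left_eq_sub]
  split_ifs
  · exact hmem
  · rw [sub_zero]
    exact zero_mem _

theorem eq_of_agree (h' : HasTriangle R D' t m b o p q s₁ s₂ s₃ S)
    (hg : D'.IsEdgeColoring Q R g) (hg' : D'.IsEdgeColoring Q R g')
    (hagree : ∀ a, a ∉ inner D' t m b → g' a = g a) : g' = g := by
  obtain ⟨ht, -, hcol⟩ := h'.colors hg
  obtain ⟨ht', -, hcol'⟩ := h'.colors hg'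
  obtain ⟨i₁, i₂, i₃, i₄, i₅, i₆⟩ := h'.not_mem_inner
  rw [hagree _ i₁, hagree _ i₂, hagree _ i₃, hagree _ i₅, hagree _ i₆] at hcol'
  obtain ⟨hm, hb⟩ := hcol'.unique hcol
  funext a
  by_cases ha : a ∈ inner D' t m b
  · rcases ha with rfl | rfl | rfl
    · rw [ht, ht', hagree _ i₁]
    · exact hm
    · exact hb
  · exact hagree a ha

end HasTriangle

end ThirdMove

/-! ### Invariance -/

/-- Each permitted move between diagrams with the same edges carries a coloring to a unique
coloring, and changes the chains by boundaries. -/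
theorem MarkedMove.existsUnique_coloring {X C F : Type*} {Q : PartialQuandle X}
    {R : C → C → Prop} {D D' : LinkDiagram C F} {I : Set F} (h : MarkedMove R D D' I) {g : F → X}
    (hg : D.IsEdgeColoring Q R g) :
    ∃ g', D'.IsEdgeColoring Q R g' ∧ (∀ a, a ∉ I → g' a = g a) ∧
      (∀ i, D'.edgeChain Q R g' i - D.edgeChain Q R g i ∈ Q.boundary₃.range) ∧
      ∀ g'', D'.IsEdgeColoring Q R g'' → (∀ a, a ∉ I → g'' a = g a) → g'' = g' := by
  have hzero : ∀ {x y : Q.Chain₂}, x = y → x - y ∈ Q.boundary₃.range := by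
    rintro x _ rfl
    rw [sub_self]
    exact zero_mem _
  induction h with
  | isotopy =>
    exact ⟨g, hg, fun _ _ => rfl, fun i => hzero rfl,
      fun g'' _ hagree => funext fun a => hagree a (Set.notMem_empty a)⟩
  | first D' e h =>
    exact ⟨g, h.isEdgeColoring_iff.2 hg, fun _ _ => rfl, fun i => hzero (h.edgeChain_eq hg i),
      fun g'' hg'' hagree => h.eq_of_agree hg (h.isEdgeColoring_iff.1 hg'') hagree⟩
  | first_inv D' e h =>
    have hg' := h.isEdgeColoring_iff.1 hg
    refine ⟨g, hg', fun _ _ => rfl, fun i => hzero (h.edgeChain_eq hg' i).symm,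
      fun g'' hg'' hagree => h.eq_of_agree hg' hg'' ?_⟩
    rwa [← h.1]
  | second D' t b h =>
    obtain ⟨g', hg', hagree⟩ := h.exists_above hg
    refine ⟨g', hg', hagree, fun i => hzero (h.edgeChain_eq hg' hagree i),
      fun g'' hg'' hagree' => h.eq_of_agree' hg' hg'' fun a ha => ?_⟩
    rw [hagree' a ha, hagree a ha]
  | second_inv D' t b h =>
    rw [h.1]
    obtain ⟨g', hg', hagree⟩ := h.exists_below hg
    refine ⟨g', hg', hagree,
      fun i => hzero (h.edgeChain_eq hg (fun a ha => (hagree a ha).symm) i).symm,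
      fun g'' hg'' hagree' => h.eq_of_agree hg' hg'' fun a ha => ?_⟩
    rw [hagree' a ha, hagree a ha]
  | third D' t m b h =>
    obtain ⟨o, p, q, s₁, s₂, s₃, S, hs, hD, hD'⟩ := h.hasTriangle
    obtain ⟨g', hg', hagree, hmem⟩ := hD.exists_coloring hD' hs h.1 h.2.1 hg
    refine ⟨g', hg', hagree, hmem, fun g'' hg'' hagree' => hD'.eq_of_agree hg' hg'' fun a ha => ?_⟩
    rw [HasTriangle.inner, h.1] at ha
    rw [hagree' a ha, hagree a ha]

theorem PartialQuandle.homologyClass_eq {X : Type*} {Q : PartialQuandle X} {z z' : Q.Chain₂}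
    (hz : z ∈ Q.cycles₂) (hz' : z' ∈ Q.cycles₂) (h : z' - z ∈ Q.boundary₃.range) :
    Q.homologyClass z' hz' = Q.homologyClass z hz := by
  refine ((QuotientAddGroup.eq (s := Q.boundary₃.range.addSubgroupOf Q.cycles₂)).2 ?_).symm
  rw [AddSubgroup.mem_addSubgroupOf]
  simpa [neg_add_eq_sub] using h

theorem theorem3p18 {X C E : Type*} (Q : PartialQuandle X) (R : C → C → Prop)
    (D : LinkDiagram C E) (f : TypeTwoColoring Q R D) :
    ∃ hz : ∀ i, f.chain i ∈ Q.cycles₂,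
      ∀ {E' F : Type*} (D' : LinkDiagram C E') (μ : ReidemeisterMove F R D D'),
        (∃! f' : TypeTwoColoring Q R D', μ.Corresponds f f') ∧
        ∀ f' : TypeTwoColoring Q R D', μ.Corresponds f f' →
          ∃ hz' : ∀ i, f'.chain i ∈ Q.cycles₂,
            ∀ i, Q.homologyClass (f'.chain i) (hz' i) = Q.homologyClass (f.chain i) (hz i) := by
  refine ⟨f.chain_mem_cycles₂, fun {E' F} D' μ => ?_⟩
  obtain ⟨g, hg, hagree, hmem, huniq⟩ :=
    μ.move.existsUnique_coloring (μ.subdivision.isEdgeColoring f.isEdgeColoring)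
  -- A coloring corresponds to `f` if and only if it is `g` on the edges of the subdivision.
  have hcorr : ∀ f' : TypeTwoColoring Q R D', μ.Corresponds f f' →
      f'.edgeColor ∘ μ.piece' = g := fun f' hf' =>
    huniq _ (μ.subdivision'.isEdgeColoring f'.isEdgeColoring) hf'
  refine ⟨⟨TypeTwoColoring.ofEdgeColoring (μ.subdivision'.isEdgeColoring_comp_last hg), ?_, ?_⟩,
    fun f' hf' => ⟨f'.chain_mem_cycles₂, fun i => ?_⟩⟩
  · intro a ha
    exact (μ.subdivision'.color_last_piece hg a).trans (hagree a ha)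
  · intro f' hf'
    refine TypeTwoColoring.edgeColor_injective ?_
    rw [TypeTwoColoring.edgeColor_ofEdgeColoring, ← hcorr f' hf']
    funext e
    exact congrArg f'.edgeColor (μ.subdivision'.piece_last e).symm
  · refine PartialQuandle.homologyClass_eq _ _ ?_
    rw [f'.chain_eq_edgeChain, f.chain_eq_edgeChain,
      ← μ.subdivision.edgeChain_comp_piece f.edgeColor, ← μ.subdivision'.edgeChain_comp_piece,
      hcorr f' hf']
    exact hmem i
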